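/- Let $g\ge 0$, $s,t\ge 0$ be integers and let $\lambda,\mu$ be partitions of the same integer $d$, with $2s+t=\ell(\lambda)+\ell(\mu)+2g-2$. **Branch data.** An *$(s,t)$-distribution* $\underline z=\underline x\sqcup\underline y$ consists of $s$ pairs $x_i=(x'_{2i-1},x'_{2i})$ of reals, $x'_1<\dots<x'_{2s}$, and $t$ reals $y_1<\dots<y_t$, none of which lies in an interval $[x'_{2i-1},x'_{2i}]$; its members are ordered $z_1<\dots<z_{s+t}$. An *$(s,t)$-tuple* $\Lambda_{s,t}=(\Lambda_1,\dots,\Lambda_{s+t})$ is a sequence of partitions of $d$, of which $s$ equal $(3,1,\dots,1)$ and $t$ equal $(2,1,\dots,1)$. It is *compatible* with $\underline z$ if $\Lambda_k=(3,1,\dots,1)$ iff $z_k\in\underline x$ and $\Lambda_k=(2,1,\dots,1)$ iff $z_k\in\underline y$. For $w_1<\dots<w_{2s+t}$ the *trivial* distribution has pairs $(w_1,w_2),\dots,(w_{2s-1},w_{2s})$ and single points $w_{2s+1},\dots,w_{2s+t}$. **Covers.** A *tropical curve* is a finite connected metric graph with only $1$-valent vertices (leaves) and $3$-valent (inner) vertices,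 the edges at leaves (*ends*) being infinite and all others (*inner edges*) finite. A *tropical cover* of type $(g,\lambda,\mu,\underline z)$ is a continuous map $\varphi:C\to\mathbb R\cup\{\pm\infty\}$ from a tropical curve with first Betti number $g$, affine on each edge $e$ with slope a positive integer $\omega(e)$ (its *weight*), balanced at inner vertices (each edge oriented in the direction of increasing $\varphi$, the total incoming and outgoing weights agree), such that the image of the set of inner vertices is the set of all $x'_i$ and $y_j$, the leaves map to $\pm\infty$, and the weights of the ends over $-\infty$ (resp. $+\infty$) are the entries of $\lambda$ (resp. $\mu$). Covers are isomorphic if there is an isometry of the curves commuting with the maps. "Even" and "odd" edge refer to the weight. A *symmetric cycle* is a pair of inner edges of equal weight with the same two endpoints; a *symmetric fork* is a pair of ends of equal weight at the same inner vertex. The cover is *resolving* if for each $i$ the vertices $v,v'$ over $x'_{2i-1},x'_{2i}$ are joined by an edge and form one of these pictures: (a) two edges of equal weight forming a symmetric cycle or fork enter $v$, one edge goes from $v$ to $v'$, and a further edge enters $v'$; (b) the mirror image of (a); (c) one edge enters $v$, two leave $v$, exactly one of which goes to $v'$, where it meets a second incoming edge; (d) two edges, not both odd, go from $v$ to $v'$.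 Edges from $v$ to $v'$ are *contractible*. Let $\mathrm{Sym}_3$ (resp. $\mathrm{Sym}_2$) be the set of symmetric cycles and forks that contain no contractible edge and are (resp. are not) adjacent to a contractible edge. A *generalized zigzag cover* is a resolving cover for which there is a connected closed subgraph $S\subset C\setminus\mathrm{Sym}_2$ with at least one inner vertex such that $S$ contains all contractible edges, every even edge of $S$ is contractible, and every connected component of $C\setminus S$ is a *tail*: a chain which, starting at a vertex of $S$, consists of edges of one even weight and of any number ($\ge 0$) of symmetric cycles of odd weight inserted between them, and which ends in a leaf or in a symmetric fork. **Multiplicity.** A *colouring* $\rho$ is a set $I$ of symmetric cycles and forks, together with a colour, red or blue, for each component of the subgraph of the even edges not in elements of $I$. At an inner vertex let $e$ be the edge that lies alone on its side and $a,b$ the two edges on the other side. The vertex is positive if: $e$ and one of $a,b$ are odd and the other is blue; or all three are even, $\{a,b\}\notin I$, and all are blue; or $a,b$ are odd, $\{a,b\}\notin I$ and $e$ is red; or $\{a,b\}\in I$ and $e$ is blue. It is negative if this holds with the colours exchanged. The colouring is *effective* if the two vertices over each pair have the same sign, $\mathrm{Sym}_3\subset I$, and $I$ contains no symmetric cycle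 with a contractible edge. Put $$\operatorname{mult}(\varphi,\rho)=2^{\,|E\setminus E_c|+|\mathrm{Symc}\cap\mathrm{Sym}_3|+|\mathrm{Nsym}_c|-|\mathrm{Sym}_2|}\prod_{p\in\mathrm{Symc}\cap I}\omega(p),$$ where $E$ is the set of even inner edges not in elements of $I$, $E_c$ the set of even contractible edges, $\mathrm{Symc}$ the set of symmetric cycles, $\mathrm{Nsym}_c$ the set of pairs of even contractible edges with the same endpoints and different weights, and $\omega(p)$ the weight of an edge of $p$. Let $m(\varphi)=0$ if $\operatorname{mult}(\varphi,\rho)$ is an odd integer for an effective $\rho$, and $m(\varphi)=1$ otherwise. **The two numbers.** The *generalized zigzag number* $Z_g(\lambda,\mu;\Lambda_{s,t})$ is $\sum_{[\varphi]}2^{m(\varphi)}$, over the isomorphism classes of generalized zigzag covers of type $(g,\lambda,\mu,\underline z)$, where $\underline z$ is an $(s,t)$-distribution compatible with $\Lambda_{s,t}$. The *proper zigzag number* $Z_g(\lambda,\mu;s,t)$ is the number of isomorphism classes of *properly mixed* covers: generalized zigzag covers of type $(g,\lambda,\mu,\underline z)$ with $\underline z$ a trivial $(s,t)$-distribution such that,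 for some $S$ as above, there is an odd inner edge $E_c\subset S$, oriented from $v_1$ to $v_2$, with the following properties. Removing the interior of $E_c$ leaves two components; the inner vertices of one lie over the points of the pairs, those of the other over the single points. There is a vertex $v_1'$ such that $(v_1',v_1)$ lies over $x_1$ and forms picture (c) in which the contractible edge is even and the other edges are odd, and the two incoming odd edges of this picture are ends of $C$ of the same weight. Finally, $v_2$ lies over $w_{2s+t}$ and has two odd incoming edges. **Theorem.** For every $(s,t)$-tuple $\Lambda_{s,t}$, every $\underline z$ compatible with it and every $w_1<\dots<w_{2s+t}$, both sets of isomorphism classes are finite, and $$Z_g(\lambda,\mu;s,t)\le Z_g(\lambda,\mu;\Lambda_{s,t}).$$ -/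

import Mathlib

open scoped ENNReal

noncomputable section

namespace Zigzag

/-! ### Branch data -/

/-- An `(s,t)`-distribution: `s` pairs `(lo i, hi i)` of real numbers with
`lo 0 < hi 0 < lo 1 < hi 1 < ⋯`, and `t` real numbers `y 0 < y 1 < ⋯`, none of which lies in one
of the closed intervals `[lo i, hi i]`. -/
structure Distribution (s t : ℕ) where
  lo : Fin s → ℝ
  hi : Fin s → ℝ
  y : Fin t → ℝ
  lo_lt_hi : ∀ i, lo i < hi i
  hi_lt_lo : ∀ i j, i < j → hi i < lo j
  y_strictMono : StrictMono y
  y_notMem : ∀ i j, y j ∉ Set.Icc (lo i) (hi i)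

/-- The set of all members of the pairs. -/
def Distribution.pairPoints {s t : ℕ} (z : Distribution s t) : Set ℝ :=
  Set.range z.lo ∪ Set.range z.hi

/-- The set of all single points. -/
def Distribution.singlePoints {s t : ℕ} (z : Distribution s t) : Set ℝ :=
  Set.range z.y

/-- The partition `p` is `(3,1,…,1)`. -/
def IsTriple {d : ℕ} (p : Nat.Partition d) : Prop :=
  p.parts = 3 ::ₘ Multiset.replicate (d - 3) 1

/-- The partition `p` is `(2,1,…,1)`. -/
def IsSimple {d : ℕ} (p : Nat.Partition d) : Prop :=
  p.parts = 2 ::ₘ Multiset.replicate (d - 2) 1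

/-- An `(s,t)`-tuple: a sequence of `s + t` partitions of `d`, of which `s` are `(3,1,…,1)` and
the remaining `t` are `(2,1,…,1)`. -/
def IsTuple {d : ℕ} (s t : ℕ) (Λ : Fin (s + t) → Nat.Partition d) : Prop :=
  {k | IsTriple (Λ k)}.ncard = s ∧ {k | IsSimple (Λ k)}.ncard = t

/-- The place on the real line of a member (pair or single point) of a distribution. A single
point is never inside the interval of a pair, so pairs may be compared through `lo`. -/
def Distribution.place {s t : ℕ} (z : Distribution s t) : Fin s ⊕ Fin t → ℝ :=
  Sum.elim z.lo z.y

/-- `z` is compatible with `Λ`: if the pairs and single points of `z` are listed in increasing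
order as `z_1 < ⋯ < z_{s+t}` (this is `enum`), then `Λ_k = (3,1,…,1)` iff `z_k` is a pair, and
`Λ_k = (2,1,…,1)` iff `z_k` is a single point. -/
def Distribution.Compatible {d s t : ℕ} (z : Distribution s t)
    (Λ : Fin (s + t) → Nat.Partition d) : Prop :=
  ∃ enum : Fin (s + t) ≃ Fin s ⊕ Fin t,
    StrictMono (fun k => z.place (enum k)) ∧
    ∀ k, (IsTriple (Λ k) ↔ (enum k).isLeft) ∧ (IsSimple (Λ k) ↔ (enum k).isRight)

/-- The trivial `(s,t)`-distribution given by `w_1 < ⋯ < w_{2s+t}`: the pairs are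
`(w_1,w_2), …, (w_{2s-1},w_{2s})` and the single points are `w_{2s+1}, …, w_{2s+t}`. -/
def trivialDistribution (s t : ℕ) (w : Fin (2 * s + t) → ℝ) (hw : StrictMono w) :
    Distribution s t where
  lo i := w ⟨2 * i.1, by omega⟩
  hi i := w ⟨2 * i.1 + 1, by omega⟩
  y j := w ⟨2 * s + j.1, by omega⟩
  lo_lt_hi i := hw (by rw [Fin.lt_def]; simp)
  hi_lt_lo i j h := hw (by rw [Fin.lt_def] at h ⊢; simp only; omega)
  y_strictMono i j h := hw (by rw [Fin.lt_def] at h ⊢; simp only; omega)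
  y_notMem i j h := by
    have h1 : w ⟨2 * i.1 + 1, by omega⟩ < w ⟨2 * s + j.1, by omega⟩ :=
      hw (by rw [Fin.lt_def]; simp only; omega)
    exact absurd h.2 (not_le.mpr h1)

/-! ### Tropical curves and tropical covers -/

/-- A tropical curve: a connected finite metric graph (multiple edges allowed) all of whose
vertices are `1`-valent or `3`-valent, in which exactly the edges incident to a `1`-valent vertex
have infinite length. The two endpoints of an edge are listed as `src` and `tgt`; for a tropical
cover this order is required below to be the one induced by the covering map. -/
structure TropicalCurve where
  V : Type
  E : Type
  [fintypeV : Fintype V]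
  [fintypeE : Fintype E]
  src : E → V
  tgt : E → V
  /-- The length of an edge. -/
  len : E → ℝ≥0∞
  len_pos : ∀ e, 0 < len e
  valence_eq : ∀ v, {e | src e = v}.ncard + {e | tgt e = v}.ncard = 1 ∨
    {e | src e = v}.ncard + {e | tgt e = v}.ncard = 3
  len_eq_top : ∀ e, len e = ⊤ ↔
    ({e' | src e' = src e}.ncard + {e' | tgt e' = src e}.ncard = 1 ∨
      {e' | src e' = tgt e}.ncard + {e' | tgt e' = tgt e}.ncard = 1)
  nonempty : Nonempty V
  connected : ∀ u v, Relation.EqvGen (fun a b => ∃ e, src e = a ∧ tgt e = b) u v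

attribute [instance] TropicalCurve.fintypeV TropicalCurve.fintypeE

namespace TropicalCurve

variable (C : TropicalCurve)

def valence (v : C.V) : ℕ := {e | C.src e = v}.ncard + {e | C.tgt e = v}.ncard

def IsLeaf (v : C.V) : Prop := C.valence v = 1

/-- Inner vertices are the `3`-valent ones. -/
def IsInner (v : C.V) : Prop := C.valence v = 3

/-- Ends are the edges incident to a leaf; the other edges are the inner edges. -/
def IsEnd (e : C.E) : Prop := C.IsLeaf (C.src e) ∨ C.IsLeaf (C.tgt e)

def Incident (e : C.E) (v : C.V) : Prop := C.src e = v ∨ C.tgt e = v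

/-- `u` and `v` are the two endpoints of `e`. -/
def Joins (e : C.E) (u v : C.V) : Prop :=
  (C.src e = u ∧ C.tgt e = v) ∨ (C.src e = v ∧ C.tgt e = u)

/-- `u` and `v` are joined by a path all of whose edges lie in `A`. -/
def Reach (A : Set C.E) (u v : C.V) : Prop :=
  Relation.EqvGen (fun a b => ∃ e ∈ A, C.src e = a ∧ C.tgt e = b) u v

/-- The first Betti number of the (connected) graph. -/
def genus : ℤ := (Fintype.card C.E : ℤ) - (Fintype.card C.V : ℤ) + 1

end TropicalCurve

open Classical in
/-- A tropical cover `φ : C → Tℙ¹ = ℝ ∪ {±∞}` of type `(g, lam, mu, z)`. The map is affine of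
slope `ω e` on each edge `e`, so that it is given by its values at the vertices and the slopes. -/
structure TropicalCover {d s t : ℕ} (g : ℕ) (lam mu : Nat.Partition d) (z : Distribution s t)
    extends TropicalCurve where
  genus_eq : toTropicalCurve.genus = g
  φ : V → EReal
  /-- The weight of an edge. -/
  ω : E → ℕ
  ω_pos : ∀ e, 0 < ω e
  /-- Every edge is listed from its lower to its upper endpoint: the orientation induced by `φ`. -/
  φ_lt : ∀ e, φ (src e) < φ (tgt e)
  /-- On an inner edge, `φ` is affine of slope `ω e`. -/
  slope : ∀ e, len e ≠ ⊤ →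
    φ (tgt e) = φ (src e) + (((ω e : ℝ) * (len e).toReal : ℝ) : EReal)
  /-- The images of the inner vertices are exactly the points of the distribution. -/
  image_inner : φ '' {v | toTropicalCurve.IsInner v} =
    (fun r : ℝ => (r : EReal)) '' (z.pairPoints ∪ z.singlePoints)
  /-- The leaves are mapped to `±∞`. -/
  leaf : ∀ v, toTropicalCurve.IsLeaf v → φ v = ⊥ ∨ φ v = ⊤
  balanced : ∀ v, toTropicalCurve.IsInner v →
    ∑ e with tgt e = v, ω e = ∑ e with src e = v, ω e
  /-- The weights of the ends over `-∞` are the entries of `lam`. -/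
  ends_lam : (Finset.univ.filter (fun e => φ (src e) = ⊥)).val.map ω = lam.parts
  /-- The weights of the ends over `+∞` are the entries of `mu`. -/
  ends_mu : (Finset.univ.filter (fun e => φ (tgt e) = ⊤)).val.map ω = mu.parts

namespace TropicalCover

variable {d s t g : ℕ} {lam mu : Nat.Partition d} {z : Distribution s t}

/-- An isomorphism of tropical covers: an isometry of the curves (given by what it does on
vertices and edges) that commutes with the maps to `Tℙ¹`. -/
structure Iso (c c' : TropicalCover g lam mu z) where
  vert : c.V ≃ c'.V
  edge : c.E ≃ c'.E
  src_eq : ∀ e, c'.src (edge e) = vert (c.src e)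
  tgt_eq : ∀ e, c'.tgt (edge e) = vert (c.tgt e)
  len_eq : ∀ e, c'.len (edge e) = c.len e
  φ_eq : ∀ v, c'.φ (vert v) = c.φ v
  ω_eq : ∀ e, c'.ω (edge e) = c.ω e

instance isoSetoid (g : ℕ) (lam mu : Nat.Partition d) (z : Distribution s t) :
    Setoid (TropicalCover g lam mu z) where
  r c c' := Nonempty (Iso c c')
  iseqv :=
    { refl := fun c => ⟨⟨Equiv.refl _, Equiv.refl _, fun _ => rfl, fun _ => rfl, fun _ => rfl,
        fun _ => rfl, fun _ => rfl⟩⟩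
      symm := by
        rintro c c' ⟨f⟩
        exact ⟨⟨f.vert.symm, f.edge.symm,
          fun e => by rw [Equiv.eq_symm_apply, ← f.src_eq, Equiv.apply_symm_apply],
          fun e => by rw [Equiv.eq_symm_apply, ← f.tgt_eq, Equiv.apply_symm_apply],
          fun e => by rw [← f.len_eq, Equiv.apply_symm_apply],
          fun v => by rw [← f.φ_eq, Equiv.apply_symm_apply],
          fun e => by rw [← f.ω_eq, Equiv.apply_symm_apply]⟩⟩
      trans := by
        rintro c c' c'' ⟨f⟩ ⟨h⟩
        exact ⟨⟨f.vert.trans h.vert, f.edge.trans h.edge,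
          fun e => by simp [h.src_eq, f.src_eq],
          fun e => by simp [h.tgt_eq, f.tgt_eq],
          fun e => by simp [h.len_eq, f.len_eq],
          fun v => by simp [h.φ_eq, f.φ_eq],
          fun e => by simp [h.ω_eq, f.ω_eq]⟩⟩ }

variable (c : TropicalCover g lam mu z)

/-! ### Symmetric cycles and forks, resolving covers

A symmetric cycle or fork is recorded as the two-element set of its edges. -/

/-- Two inner edges of the same weight with the same two endpoints. -/
def IsSymCycle (p : Set c.E) : Prop :=
  ∃ a b, a ≠ b ∧ p = {a, b} ∧ ¬ c.IsEnd a ∧ ¬ c.IsEnd b ∧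
    c.src a = c.src b ∧ c.tgt a = c.tgt b ∧ c.ω a = c.ω b

/-- Two ends of the same weight that are adjacent to the same inner vertex. -/
def IsSymFork (p : Set c.E) : Prop :=
  ∃ a b, a ≠ b ∧ p = {a, b} ∧ c.IsEnd a ∧ c.IsEnd b ∧
    (∃ v, c.IsInner v ∧ c.Incident a v ∧ c.Incident b v) ∧ c.ω a = c.ω b

/-- `v` and `v'` look like this, with `a` and `b` of the same weight `k`, and `{a, b}` is a
symmetric cycle or fork:
`a, b` enter `v`; the edge `e` (of weight `2k`) goes from `v` to `v'`; another edge `f` (even or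
odd) enters `v'`. -/
def PictureJoin (v v' : c.V) : Prop :=
  ∃ a b e f, a ≠ b ∧ e ≠ f ∧ c.tgt a = v ∧ c.tgt b = v ∧ c.src e = v ∧ c.tgt e = v' ∧
    c.tgt f = v' ∧ c.ω a = c.ω b ∧ (c.IsSymCycle {a, b} ∨ c.IsSymFork {a, b})

/-- The mirror image of the previous picture: one edge enters `v`, another edge `f` (even or odd)
leaves `v`; the edge `e` (of weight `2k`) goes from `v` to `v'`; `a, b`, both of weight `k`, leave
`v'`, and `{a, b}` is a symmetric cycle or fork. -/
def PictureSplit (v v' : c.V) : Prop :=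
  ∃ a b e f, a ≠ b ∧ e ≠ f ∧ c.src a = v' ∧ c.src b = v' ∧ c.src e = v ∧ c.tgt e = v' ∧
    c.src f = v ∧ c.ω a = c.ω b ∧ (c.IsSymCycle {a, b} ∨ c.IsSymFork {a, b})

/-- `i` enters `v`; `f` and `e` leave `v`, where `e` goes on to `v'` and `f` is not the edge `j`;
`j` and `e` enter `v'`, from which one edge leaves. -/
def PictureCross (v v' : c.V) (i f e j : c.E) : Prop :=
  c.tgt i = v ∧ c.src f = v ∧ c.src e = v ∧ c.tgt e = v' ∧ c.tgt j = v' ∧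
    f ≠ e ∧ j ≠ e ∧ f ≠ j

/-- The crossing picture in which `i`, `f`, `j` have odd weight and the contractible edge `e` has
even weight (so that the edge leaving `v'` has odd weight). -/
def PictureCrossOdd (v v' : c.V) (i f e j : c.E) : Prop :=
  c.PictureCross v v' i f e j ∧ Odd (c.ω i) ∧ Odd (c.ω f) ∧ Even (c.ω e) ∧ Odd (c.ω j)

/-- Two edges go from `v` to `v'`, and they are not both of odd weight. -/
def PictureCycle (v v' : c.V) : Prop :=
  ∃ a b, a ≠ b ∧ c.src a = v ∧ c.tgt a = v' ∧ c.src b = v ∧ c.tgt b = v' ∧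
    (Even (c.ω a) ∨ Even (c.ω b))

/-- A resolving tropical cover: the two inner vertices over each pair of points form one of the
admissible pictures, of which there are fourteen when the parities are distinguished. (In
`PictureJoin` and `PictureSplit` the edge `f` may be even or odd, in `PictureCross` each of the
eight parity patterns of `i, e, j` may occur, and in `PictureCycle` exactly one or both of the
edges are even: `2 + 2 + 8 + 2`.) -/
def IsResolving : Prop :=
  ∀ k : Fin s, ∃ v v', c.IsInner v ∧ c.IsInner v' ∧
    c.φ v = (z.lo k : EReal) ∧ c.φ v' = (z.hi k : EReal) ∧
    (c.PictureJoin v v' ∨ c.PictureSplit v v' ∨ (∃ i f e j, c.PictureCross v v' i f e j) ∨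
      c.PictureCycle v v')

/-- The contractible edges are those connecting the two vertices over a pair of points. -/
def IsContractible (e : c.E) : Prop :=
  ∃ k : Fin s, c.φ (c.src e) = (z.lo k : EReal) ∧ c.φ (c.tgt e) = (z.hi k : EReal)

/-- `Symc(φ)`, the set of symmetric cycles. -/
def symc : Set (Set c.E) := {p | c.IsSymCycle p}

/-- `Sym(φ)`, the set of symmetric cycles and symmetric forks. -/
def sym : Set (Set c.E) := {p | c.IsSymCycle p ∨ c.IsSymFork p}

/-- `E_c(φ)`, the set of even contractible edges. -/
def evenContractible : Set c.E := {e | Even (c.ω e) ∧ c.IsContractible e}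

/-- Some edge of `p` has a common endpoint with a contractible edge. -/
def AdjacentToContractible (p : Set c.E) : Prop :=
  ∃ a ∈ p, ∃ e v, c.IsContractible e ∧ c.Incident a v ∧ c.Incident e v

/-- The symmetric cycles and forks without contractible edges. -/
def nonContractibleSym : Set (Set c.E) := {p | p ∈ c.sym ∧ ∀ a ∈ p, ¬ c.IsContractible a}

/-- `Sym_3(φ)`: non-contractible symmetric cycles and forks adjacent to a contractible edge. -/
def sym3 : Set (Set c.E) := {p | p ∈ c.nonContractibleSym ∧ c.AdjacentToContractible p}

/-- `Sym_2(φ)`: non-contractible symmetric cycles and forks not adjacent to a contractible edge. -/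
def sym2 : Set (Set c.E) := {p | p ∈ c.nonContractibleSym ∧ ¬ c.AdjacentToContractible p}

/-- `Symc_c(φ)`: the contractible symmetric cycles. -/
def symcContractible : Set (Set c.E) := {p | p ∈ c.symc ∧ ∃ a ∈ p, c.IsContractible a}

/-- `Nsym_c(φ)`: the non-symmetric cycles consisting of two even contractible edges. -/
def nsymContractible : Set (Set c.E) :=
  {p | ∃ a b, a ≠ b ∧ p = {a, b} ∧ c.src a = c.src b ∧ c.tgt a = c.tgt b ∧ c.ω a ≠ c.ω b ∧
    a ∈ c.evenContractible ∧ b ∈ c.evenContractible}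

/-! ### Generalized zigzag covers -/

/-- `IsTail v vs es`: the vertices `vs` and the edges `es` form a tail attached at the vertex `v`,
which is not part of the tail. From `v` one follows an edge `e`, then any number (possibly zero)
of symmetric cycles of odd weight, consecutive ones being connected by an edge; the last edge
ends in a leaf, or in a symmetric fork. The weight of all edges outside the cycles and the fork is
the same even number. -/
inductive IsTail : c.V → Set c.V → Set c.E → Prop
  | leaf (v u : c.V) (e : c.E) : c.Joins e v u → c.IsLeaf u → Even (c.ω e) → IsTail v {u} {e}
  | fork (v u x x' : c.V) (e a b : c.E) : c.Joins e v u → c.Joins a u x → c.Joins b u x' →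
      e ≠ a → e ≠ b → c.IsInner u → c.IsLeaf x → c.IsLeaf x' → c.IsSymFork {a, b} →
      IsTail v {u, x, x'} {e, a, b}
  | cycle (v u u' : c.V) (e a b : c.E) (vs : Set c.V) (es : Set c.E) : c.Joins e v u →
      c.Joins a u u' → c.Joins b u u' → e ≠ a → e ≠ b → c.IsSymCycle {a, b} → Odd (c.ω a) →
      IsTail u' vs es → a ∉ es → b ∉ es →
      IsTail v ({u, u'} ∪ vs) ({e, a, b} ∪ es)

/-- The closed subgraph `S` of `C` with vertices `VS` and edges `ES` has the properties required in
the definition of generalized zigzag covers. In `tails`, note that all edges at the vertices of a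
tail belong to the tail; therefore a tail that is attached to `S` and disjoint from `S` is a
connected component of `C ∖ S`, and `tails` says that every connected component of `C ∖ S` is a
tail. -/
structure IsZigzagCore (VS : Set c.V) (ES : Set c.E) : Prop where
  closed : ∀ e ∈ ES, c.src e ∈ VS ∧ c.tgt e ∈ VS
  connected : ∀ u ∈ VS, ∀ v ∈ VS, c.Reach ES u v
  /-- `S` does not meet the (closed) edges of the elements of `Sym_2(φ)`. -/
  disjoint_sym2 : ∀ p ∈ c.sym2, ∀ e ∈ p, e ∉ ES ∧ c.src e ∉ VS ∧ c.tgt e ∉ VS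
  contractible : ∀ e, c.IsContractible e → e ∈ ES
  inner : ∃ v ∈ VS, c.IsInner v
  even : ∀ e ∈ ES, Even (c.ω e) → c.IsContractible e
  tails : (∀ u, u ∉ VS → ∃ v ∈ VS, ∃ vs es, c.IsTail v vs es ∧
      Disjoint vs VS ∧ Disjoint es ES ∧ u ∈ vs) ∧
    (∀ e, e ∉ ES → ∃ v ∈ VS, ∃ vs es, c.IsTail v vs es ∧
      Disjoint vs VS ∧ Disjoint es ES ∧ e ∈ es)

/-- Generalized zigzag covers. -/
def IsGenZigzag : Prop :=
  c.IsResolving ∧ ∃ VS ES, c.IsZigzagCore VS ES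

/-! ### Colourings and multiplicities -/

/-- The edge `e` belongs to an element of `I`. -/
def Dotted (I : Set (Set c.E)) (e : c.E) : Prop := ∃ p ∈ I, e ∈ p

/-- A colouring of a tropical cover: a subset `I` of `Sym(φ)`, and a colour (`true` is blue and
`false` is red) for each component of the subgraph of the edges of even weight that do not belong
to elements of `I`. The values of `colour` at other edges are irrelevant and never used. -/
structure Colouring where
  I : Set (Set c.E)
  I_subset : I ⊆ c.sym
  colour : c.E → Bool
  colour_eq : ∀ e e' v, Even (c.ω e) → Even (c.ω e') → ¬ c.Dotted I e → ¬ c.Dotted I e' →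
    c.Incident e v → c.Incident e' v → colour e = colour e'

/-- `a, b, e` are the three edges at `v`, and `e` is the one that lies alone on its side. -/
def IsStar (v : c.V) (a b e : c.E) : Prop :=
  a ≠ b ∧ ((c.tgt e = v ∧ c.src a = v ∧ c.src b = v) ∨
    (c.src e = v ∧ c.tgt a = v ∧ c.tgt b = v))

/-- The inner vertex `v` is positive (`σ = true`) or negative (`σ = false`). The four
alternatives, for a positive vertex: the only even edge is one of the two edges on the same side,
and it is blue; all three edges are even and blue; the two edges on the same side are odd and
do not form an element of `I`, and the third edge is red; the two edges on the same side
form an element of `I` and the third edge is blue. -/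
def HasSign (ρ : c.Colouring) (σ : Bool) (v : c.V) : Prop :=
  ∃ a b e, c.IsStar v a b e ∧
    ((Odd (c.ω e) ∧ Odd (c.ω a) ∧ Even (c.ω b) ∧ ρ.colour b = σ) ∨
     (Even (c.ω e) ∧ Even (c.ω a) ∧ Even (c.ω b) ∧ {a, b} ∉ ρ.I ∧
        ρ.colour e = σ ∧ ρ.colour a = σ ∧ ρ.colour b = σ) ∨
     (Odd (c.ω a) ∧ Odd (c.ω b) ∧ {a, b} ∉ ρ.I ∧ ρ.colour e = !σ) ∨
     ({a, b} ∈ ρ.I ∧ ρ.colour e = σ))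

/-- Effective colourings. -/
def IsEffective (ρ : c.Colouring) : Prop :=
  (∀ (k : Fin s) (v v' : c.V), c.φ v = (z.lo k : EReal) → c.φ v' = (z.hi k : EReal) →
    ∃ σ, c.HasSign ρ σ v ∧ c.HasSign ρ σ v') ∧
  c.sym3 ⊆ ρ.I ∧ c.symcContractible ∩ ρ.I = ∅

/-- The inner edges of even weight that do not belong to elements of `I`. -/
def evenInner (I : Set (Set c.E)) : Set c.E :=
  {e | ¬ c.IsEnd e ∧ Even (c.ω e) ∧ ¬ c.Dotted I e}

/-- The real multiplicity of a coloured resolving tropical cover. In the product,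
`sSup (c.ω '' p)` is the common weight of the two edges of the symmetric cycle `p`. -/
def mult (ρ : c.Colouring) : ℚ :=
  (2 : ℚ) ^ ((c.evenInner ρ.I \ c.evenContractible).ncard + (c.symc ∩ c.sym3).ncard +
      c.nsymContractible.ncard) / (2 : ℚ) ^ c.sym2.ncard *
    ((∏ᶠ p ∈ c.symc ∩ ρ.I, sSup (c.ω '' p) : ℕ) : ℚ)

/-- The multiplicity is odd for an effective colouring. -/
def HasOddMult : Prop :=
  ∃ ρ : c.Colouring, c.IsEffective ρ ∧ ∃ n : ℤ, Odd n ∧ c.mult ρ = n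

end TropicalCover

/-! ### Zigzag numbers and proper zigzag numbers -/

variable {d s t : ℕ}

/-- Isomorphism classes of generalized zigzag covers of type `(g, lam, mu, z)`. -/
def ZigzagClasses (g : ℕ) (lam mu : Nat.Partition d) (z : Distribution s t) : Type 1 :=
  Quotient ((TropicalCover.isoSetoid g lam mu z).comap
    (Subtype.val : {c : TropicalCover g lam mu z // c.IsGenZigzag} → _))

open Classical in
/-- The exponent `m`: it is `0` if the multiplicity is odd for an effective colouring, and `1`
otherwise. -/
def zigzagExponent {g : ℕ} {lam mu : Nat.Partition d} {z : Distribution s t}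
    (q : ZigzagClasses g lam mu z) : ℕ :=
  if q.out.1.HasOddMult then 0 else 1

/-- The generalized zigzag number: the sum of `2 ^ m` over the isomorphism classes of generalized
zigzag covers. -/
def zigzagNumber (g : ℕ) (lam mu : Nat.Partition d) (z : Distribution s t) : ℕ :=
  ∑ᶠ q : ZigzagClasses g lam mu z, 2 ^ zigzagExponent q

/-- The generalized zigzag cover `c` over the trivial distribution given by `w` is properly mixed.
Here `Ec` is the characteristic edge, with endpoints `v₁ = src Ec` and `v₂ = tgt Ec`. -/
def IsProperlyMixed {g : ℕ} {lam mu : Nat.Partition d} {w : Fin (2 * s + t) → ℝ}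
    {hw : StrictMono w} (c : TropicalCover g lam mu (trivialDistribution s t w hw)) : Prop :=
  c.IsResolving ∧ ∃ VS ES, c.IsZigzagCore VS ES ∧ ∃ Ec ∈ ES,
    Odd (c.ω Ec) ∧ ¬ c.IsEnd Ec ∧
    -- removing the interior of `Ec` disconnects the curve,
    ¬ c.Reach {e | e ≠ Ec} (c.src Ec) (c.tgt Ec) ∧
    -- the inner vertices of the part at `v₁` lie over the pairs (as `v₁` itself does, by the
    -- condition on the picture below), those of the part at `v₂` over the single points,
    (∀ v, c.IsInner v → c.Reach {e | e ≠ Ec} (c.src Ec) v →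
      ∃ r ∈ (trivialDistribution s t w hw).pairPoints, c.φ v = (r : EReal)) ∧
    (∀ v, c.IsInner v → c.Reach {e | e ≠ Ec} (c.tgt Ec) v →
      ∃ r ∈ (trivialDistribution s t w hw).singlePoints, c.φ v = (r : EReal)) ∧
    -- some `(v₁', v₁)` lies over the first pair and has the required picture, in which the two
    -- odd incoming edges `i` and `j` are ends of the same weight,
    (∃ v₁' i f e j, (∃ k : Fin s, k.1 = 0 ∧
        c.φ v₁' = ((trivialDistribution s t w hw).lo k : EReal) ∧
        c.φ (c.src Ec) = ((trivialDistribution s t w hw).hi k : EReal)) ∧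
      c.PictureCrossOdd v₁' (c.src Ec) i f e j ∧ c.IsEnd i ∧ c.IsEnd j ∧ c.ω i = c.ω j) ∧
    -- `v₂` lies over the last point, and has two odd incoming edges (one of them is `Ec`).
    (∃ k : Fin (2 * s + t), k.1 + 1 = 2 * s + t ∧ c.φ (c.tgt Ec) = (w k : EReal)) ∧
    (∃ e, e ≠ Ec ∧ c.tgt e = c.tgt Ec ∧ Odd (c.ω e))

/-- Isomorphism classes of properly mixed generalized zigzag covers. -/
def ProperClasses (g : ℕ) (lam mu : Nat.Partition d) (s t : ℕ) (w : Fin (2 * s + t) → ℝ)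
    (hw : StrictMono w) : Type 1 :=
  Quotient ((TropicalCover.isoSetoid g lam mu (trivialDistribution s t w hw)).comap
    (Subtype.val : {c : TropicalCover g lam mu (trivialDistribution s t w hw) //
      IsProperlyMixed c} → _))

/-- The proper zigzag number. -/
def properZigzagNumber (g : ℕ) (lam mu : Nat.Partition d) (s t : ℕ) (w : Fin (2 * s + t) → ℝ)
    (hw : StrictMono w) : ℕ :=
  Nat.card (ProperClasses g lam mu s t w hw)

end Zigzag

end

namespace Zigzag

/-! ### Counting leaves, inner vertices and edges -/

namespace TropicalCover

variable {d s t g : ℕ} {lam mu : Nat.Partition d} {z : Distribution s t}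
variable (c : TropicalCover g lam mu z)

/-! Each class of generalized zigzag covers contributes `2 ^ m ≥ 1`, so it suffices to inject the
properly mixed classes over the trivial distribution into the generalized zigzag classes over `z`.

Finiteness: counting half-edges and using the Betti number shows that there are exactly `2s + t`
inner vertices, hence exactly one over each branch point (`φ_injOn`). Vertex and edge numbers are
therefore fixed, weights are at most `d` (`ω_le`), and lengths are determined by positions and
weights, so finitely many combinatorial codes describe all covers (`finite_classes`).

The injection: the points of the trivial distribution are moved to the corresponding points of `z`.
Pairs keep their order among themselves, and so do single points. In a properly mixed cover the
characteristic edge `E` is the only inner edge joining a vertex over a pair to one over a single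
point, so every other edge keeps its direction. Only the position of the last single point relative
to the first pair matters. If it lies above, `E` keeps its direction too, and the same weighted
graph works (`Mark.keep`).

If it lies below, `E` would be reversed, and its neighbourhood is rewired (`Mark.cross`). Before,
the end `i` enters `u`, which emits `f` and the contractible edge `e`; then `e` and the end `j`
merge into `E`, and `E` and `o` merge into an even end `h`. Afterwards `i` and `j`, of equal odd
weight, merge at the former target of `E`; the new `E`, of weight `2 ω(i)`, runs from there to `u`;
`u` emits `f` and `e`, the latter now with the weight of the old `E`; and `e` and `o` merge into
`h`. Thus `E`, `i`, `j` become a tail ending in a symmetric fork, and the tail `h` is attached one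
vertex earlier. Removing the fork tail from the old core gives a core of the new cover
(`Mark.cross_isZigzagCore`).

Recovery: an isomorphism of rewired covers must respect the three central vertices, since there is
one inner vertex over each point. It then respects the edges named above, except that it may
exchange `i` and `j`, which an automorphism of the fork corrects. Undoing the rewiring yields an
isomorphism of the original covers (`Mark.nonempty_iso_of_cross`). -/

theorem isLeaf_or_isInner (v : c.V) : c.IsLeaf v ∨ c.IsInner v := c.valence_eq v

theorem not_isLeaf_iff {v : c.V} : ¬ c.IsLeaf v ↔ c.IsInner v := by
  have := c.isLeaf_or_isInner v
  unfold TropicalCurve.IsLeaf TropicalCurve.IsInner at *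
  omega

theorem exists_real_of_isInner {v : c.V} (hv : c.IsInner v) :
    ∃ r ∈ z.pairPoints ∪ z.singlePoints, c.φ v = ((r : ℝ) : EReal) := by
  have : c.φ v ∈ c.φ '' {v | c.IsInner v} := ⟨v, hv, rfl⟩
  rw [c.image_inner] at this
  obtain ⟨r, hr, h⟩ := this
  exact ⟨r, hr, h.symm⟩

theorem isLeaf_iff {v : c.V} : c.IsLeaf v ↔ c.φ v = ⊥ ∨ c.φ v = ⊤ := by
  refine ⟨c.leaf v, fun h => ?_⟩
  by_contra hn
  obtain ⟨r, -, hr⟩ := c.exists_real_of_isInner (c.not_isLeaf_iff.1 hn)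
  simp [hr] at h

theorem isInner_of_eq {v : c.V} {r : ℝ} (h : c.φ v = (r : EReal)) : c.IsInner v := by
  rw [← c.not_isLeaf_iff, c.isLeaf_iff]
  simp [h]

theorem isLeaf_src_iff (e : c.E) : c.IsLeaf (c.src e) ↔ c.φ (c.src e) = ⊥ := by
  rw [c.isLeaf_iff]
  exact ⟨fun h => h.resolve_right ((c.φ_lt e).trans_le le_top).ne, Or.inl⟩

theorem isLeaf_tgt_iff (e : c.E) : c.IsLeaf (c.tgt e) ↔ c.φ (c.tgt e) = ⊤ := by
  rw [c.isLeaf_iff]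
  exact ⟨fun h => h.resolve_left (bot_le.trans_lt (c.φ_lt e)).ne', Or.inr⟩

theorem src_ne_tgt (e : c.E) : c.src e ≠ c.tgt e := fun h => by
  have := c.φ_lt e
  rw [h] at this
  exact lt_irrefl _ this

theorem len_eq_top_iff (e : c.E) : c.len e = ⊤ ↔ c.IsEnd e := c.len_eq_top e

theorem not_isEnd_iff (e : c.E) : ¬ c.IsEnd e ↔ c.IsInner (c.src e) ∧ c.IsInner (c.tgt e) := by
  rw [← c.not_isLeaf_iff, ← c.not_isLeaf_iff]
  unfold TropicalCurve.IsEnd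
  tauto

open Classical in
theorem valence_eq_card (v : c.V) : c.valence v =
    (Finset.univ.filter fun e => c.src e = v).card +
      (Finset.univ.filter fun e => c.tgt e = v).card := by
  unfold TropicalCurve.valence
  rw [Set.ncard_eq_toFinset_card', Set.ncard_eq_toFinset_card']
  simp

/-- The lengths of the edges are determined by the remaining data. -/
theorem len_eq_of_eq {c c' : TropicalCover g lam mu z} (e : c.E) (e' : c'.E)
    (hs : c'.φ (c'.src e') = c.φ (c.src e)) (ht : c'.φ (c'.tgt e') = c.φ (c.tgt e))
    (hω : c'.ω e' = c.ω e) : c'.len e' = c.len e := by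
  have hend : c'.IsEnd e' ↔ c.IsEnd e := by
    unfold TropicalCurve.IsEnd
    rw [isLeaf_src_iff, isLeaf_src_iff, isLeaf_tgt_iff, isLeaf_tgt_iff, hs, ht]
  by_cases h : c.IsEnd e
  · rw [(c.len_eq_top_iff e).2 h, (c'.len_eq_top_iff e').2 (hend.2 h)]
  · have h' := fun h' => h (hend.1 h')
    have hl : c.len e ≠ ⊤ := fun h2 => h ((c.len_eq_top_iff e).1 h2)
    have hl' : c'.len e' ≠ ⊤ := fun h2 => h' ((c'.len_eq_top_iff e').1 h2)
    have h1 := c.slope e hl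
    have h2 := c'.slope e' hl'
    obtain ⟨r, -, hr⟩ := c.exists_real_of_isInner ((c.not_isEnd_iff e).1 h).1
    rw [hs, ht, h1, hω, hr, ← EReal.coe_add, ← EReal.coe_add, EReal.coe_eq_coe_iff] at h2
    have h3 : (c.ω e : ℝ) ≠ 0 := by exact_mod_cast (c.ω_pos e).ne'
    have h4 : (c.len e).toReal = (c'.len e').toReal := by
      apply mul_left_cancel₀ h3
      linarith
    exact ((ENNReal.toReal_eq_toReal_iff' hl hl').1 h4).symm

/-- An isomorphism of the underlying weighted graphs over `ℝ ∪ {±∞}` is an isometry. -/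
def Iso.mk' {c c' : TropicalCover g lam mu z} (vert : c.V ≃ c'.V) (edge : c.E ≃ c'.E)
    (src_eq : ∀ e, c'.src (edge e) = vert (c.src e))
    (tgt_eq : ∀ e, c'.tgt (edge e) = vert (c.tgt e))
    (φ_eq : ∀ v, c'.φ (vert v) = c.φ v) (ω_eq : ∀ e, c'.ω (edge e) = c.ω e) : Iso c c' where
  vert := vert
  edge := edge
  src_eq := src_eq
  tgt_eq := tgt_eq
  φ_eq := φ_eq
  ω_eq := ω_eq
  len_eq e := len_eq_of_eq e (edge e) (by rw [src_eq, φ_eq]) (by rw [tgt_eq, φ_eq]) (ω_eq e)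

-- Each leaf carries one edge, and it is the source of that edge over `-∞` and the target over `+∞`;
-- counting leaves is therefore counting the ends that make up `lam` and `mu`.
open Classical in
theorem card_leaves :
    (Finset.univ.filter fun v => c.IsLeaf v).card =
      Multiset.card lam.parts + Multiset.card mu.parts := by
  have h1 : (Finset.univ.filter fun e => c.IsLeaf (c.src e)).card = Multiset.card lam.parts := by
    rw [← c.ends_lam, Multiset.card_map, Finset.card_val]
    simp only [isLeaf_src_iff]
  have h2 : (Finset.univ.filter fun e => c.IsLeaf (c.tgt e)).card = Multiset.card mu.parts := by
    rw [← c.ends_mu, Multiset.card_map, Finset.card_val]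
    simp only [isLeaf_tgt_iff]
  have key : ∀ f : c.E → c.V, (Finset.univ.filter fun e => c.IsLeaf (f e)).card =
      ∑ v with c.IsLeaf v, (Finset.univ.filter fun e => f e = v).card := by
    intro f
    rw [Finset.card_eq_sum_card_fiberwise (f := f) (t := Finset.univ.filter fun v => c.IsLeaf v)
      (by intro e he; simpa using he)]
    refine Finset.sum_congr rfl fun v hv => ?_
    congr 1
    ext e
    simp only [Finset.mem_filter, Finset.mem_univ, true_and] at hv ⊢
    exact ⟨fun h => h.2, fun h => ⟨h ▸ hv, h⟩⟩
  rw [← h1, ← h2, key, key, ← Finset.sum_add_distrib, Finset.card_eq_sum_ones]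
  refine Finset.sum_congr rfl fun v hv => ?_
  rw [← valence_eq_card]
  exact ((Finset.mem_filter.1 hv).2).symm

open Classical in
theorem card_leaves_add_card_inner : (Finset.univ.filter fun v => c.IsLeaf v).card +
    (Finset.univ.filter fun v => c.IsInner v).card = Fintype.card c.V := by
  have : (Finset.univ.filter fun v => c.IsInner v) = Finset.univ.filter fun v => ¬ c.IsLeaf v := by
    ext v
    simp [not_isLeaf_iff]
  rw [this, Finset.card_filter_add_card_filter_not, Finset.card_univ]

open Classical in
theorem handshake : (Finset.univ.filter fun v => c.IsLeaf v).card +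
    3 * (Finset.univ.filter fun v => c.IsInner v).card = 2 * Fintype.card c.E := by
  have h1 : ∑ v, c.valence v = 2 * Fintype.card c.E := by
    simp only [valence_eq_card, Finset.sum_add_distrib]
    rw [← Finset.card_eq_sum_card_fiberwise (s := Finset.univ) (f := c.src) (by simp),
      ← Finset.card_eq_sum_card_fiberwise (s := Finset.univ) (f := c.tgt) (by simp), Finset.card_univ]
    ring
  have h2 : (Finset.univ.filter fun v => c.IsInner v) = Finset.univ.filter fun v => ¬ c.IsLeaf v := by
    ext v
    simp [not_isLeaf_iff]
  rw [← h1, ← Finset.sum_filter_add_sum_filter_not _ (fun v => c.IsLeaf v), ← h2,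
    Finset.sum_const_nat (s := Finset.univ.filter fun v => c.IsLeaf v) (m := 1)
      fun v hv => (Finset.mem_filter.1 hv).2,
    Finset.sum_const_nat (s := Finset.univ.filter fun v => c.IsInner v) (m := 3)
      fun v hv => (Finset.mem_filter.1 hv).2]
  ring

-- With `L` leaves and `I` inner vertices, `L + I = |V|`, `L + 3I = 2|E|` and `|E| - |V| + 1 = g`
-- give `I = L + 2g - 2`, which is `2s + t` by `hst`.
open Classical in
theorem card_inner (hst : 2 * s + t + 2 = Multiset.card lam.parts + Multiset.card mu.parts + 2 * g) :
    (Finset.univ.filter fun v => c.IsInner v).card = 2 * s + t := by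
  have h1 := c.card_leaves
  have h2 := c.card_leaves_add_card_inner
  have h3 := c.handshake
  have h4 := c.genus_eq
  unfold TropicalCurve.genus at h4
  omega

theorem card_V (hst : 2 * s + t + 2 = Multiset.card lam.parts + Multiset.card mu.parts + 2 * g) :
    Fintype.card c.V = Multiset.card lam.parts + Multiset.card mu.parts + (2 * s + t) := by
  classical
  rw [← c.card_leaves_add_card_inner, c.card_leaves, c.card_inner hst]

theorem card_E (hst : 2 * s + t + 2 = Multiset.card lam.parts + Multiset.card mu.parts + 2 * g) :
    Fintype.card c.E = Multiset.card lam.parts + Multiset.card mu.parts + (2 * s + t) + g - 1 := by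
  have h2 := c.card_V hst
  have h4 := c.genus_eq
  unfold TropicalCurve.genus at h4
  omega

end TropicalCover

/-! ### Branch points, the inner vertices over them, and the bound on weights -/

/-- The points of a distribution, indexed by what they are. -/
def Distribution.point {s t : ℕ} (z : Distribution s t) : (Fin s ⊕ Fin s) ⊕ Fin t → ℝ :=
  Sum.elim (Sum.elim z.lo z.hi) z.y

theorem Distribution.range_point {s t : ℕ} (z : Distribution s t) :
    Set.range z.point = z.pairPoints ∪ z.singlePoints := by
  simp [point, pairPoints, singlePoints, Set.Sum.elim_range]

theorem Distribution.lo_strictMono {s t : ℕ} (z : Distribution s t) : StrictMono z.lo :=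
  fun i j h => (z.lo_lt_hi i).trans (z.hi_lt_lo i j h)

theorem Distribution.hi_strictMono {s t : ℕ} (z : Distribution s t) : StrictMono z.hi :=
  fun i j h => (z.hi_lt_lo i j h).trans (z.lo_lt_hi j)

theorem Distribution.lo_ne_hi {s t : ℕ} (z : Distribution s t) (i j : Fin s) :
    z.lo i ≠ z.hi j := by
  rcases lt_or_ge j i with h | h
  · exact (z.hi_lt_lo j i h).ne'
  · exact ((z.lo_strictMono.monotone h).trans_lt (z.lo_lt_hi j)).ne

theorem Distribution.y_ne_lo {s t : ℕ} (z : Distribution s t) (i : Fin t) (j : Fin s) :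
    z.y i ≠ z.lo j :=
  fun h => z.y_notMem j i ⟨h.ge, h.trans_le (z.lo_lt_hi j).le⟩

theorem Distribution.y_ne_hi {s t : ℕ} (z : Distribution s t) (i : Fin t) (j : Fin s) :
    z.y i ≠ z.hi j :=
  fun h => z.y_notMem j i ⟨(z.lo_lt_hi j).le.trans h.ge, h.le⟩

theorem Distribution.point_injective {s t : ℕ} (z : Distribution s t) :
    Function.Injective z.point := by
  rintro ((i | i) | i) ((j | j) | j) h <;> simp only [point, Sum.elim_inl, Sum.elim_inr] at h
  · rw [z.lo_strictMono.injective h]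
  · exact absurd h (z.lo_ne_hi _ _)
  · exact absurd h.symm (z.y_ne_lo _ _)
  · exact absurd h.symm (z.lo_ne_hi _ _)
  · rw [z.hi_strictMono.injective h]
  · exact absurd h.symm (z.y_ne_hi _ _)
  · exact absurd h (z.y_ne_lo _ _)
  · exact absurd h (z.y_ne_hi _ _)
  · rw [z.y_strictMono.injective h]

namespace TropicalCover

variable {d s t g : ℕ} {lam mu : Nat.Partition d} {z : Distribution s t}
variable (c : TropicalCover g lam mu z)

theorem image_inner_eq_range :
    c.φ '' {v | c.IsInner v} = Set.range fun k => ((z.point k : ℝ) : EReal) := by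
  rw [c.image_inner, ← z.range_point, ← Set.range_comp]
  rfl

theorem exists_point_of_isInner {v : c.V} (hv : c.IsInner v) :
    ∃ k, c.φ v = ((z.point k : ℝ) : EReal) := by
  have : c.φ v ∈ c.φ '' {v | c.IsInner v} := ⟨v, hv, rfl⟩
  rw [c.image_inner_eq_range] at this
  obtain ⟨k, h⟩ := this
  exact ⟨k, h.symm⟩

/-- There is exactly one inner vertex over each branch point. -/
theorem φ_injOn (hst : 2 * s + t + 2 = Multiset.card lam.parts + Multiset.card mu.parts + 2 * g) :
    Set.InjOn c.φ {v | c.IsInner v} := by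
  classical
  have h := c.card_inner hst
  -- The inner vertices surject onto the branch points, and both sets have `2s + t` elements, so the
  -- surjection is injective.
  have h1 : ((Finset.univ.filter fun v => c.IsInner v) : Set c.V) = {v | c.IsInner v} := by
    simp
  rw [← h1, ← Finset.card_image_iff, h]
  have h2 : (((Finset.univ.filter fun v => c.IsInner v).image c.φ : Finset EReal) : Set EReal) =
      Set.range fun k => ((z.point k : ℝ) : EReal) := by
    rw [Finset.coe_image, h1, image_inner_eq_range]
  rw [← Set.ncard_coe_finset, h2, ← Set.image_univ, Set.ncard_image_of_injective]
  · simp [Set.ncard_univ]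
    ring
  · intro a b hab
    exact z.point_injective (EReal.coe_injective hab)

open Classical in
/-- The weights are bounded by the degree. -/
theorem ω_le (e : c.E) : c.ω e ≤ d := by
  -- Cut just above the source of `e`. By balancing, the inner vertices below the cut pass on
  -- exactly the weight they receive, so the total weight crossing the cut, `ω e` included, comes
  -- from the ends over `-∞`, of total weight `d`.
  set U : c.V → Prop := fun v => c.φ v ≤ c.φ (c.src e) with hU
  obtain ⟨W, hW⟩ : ∃ W : c.V → Prop, ∀ v, W v ↔ U v ∧ c.IsInner v := ⟨_, fun _ => Iff.rfl⟩
  have hsum : ∀ (f : c.E → c.V) (p : c.V → Prop), ∑ x with p (f x), c.ω x =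
      ∑ v with p v, ∑ x with f x = v, c.ω x := by
    intro f p
    rw [← Finset.sum_fiberwise_of_maps_to (g := f) (t := Finset.univ.filter p)
      (by intro e he; simpa using he)]
    refine Finset.sum_congr rfl fun v hv => ?_
    congr 1
    ext e
    simp only [Finset.mem_filter, Finset.mem_univ, true_and] at hv ⊢
    exact ⟨fun h => h.2, fun h => ⟨h ▸ hv, h⟩⟩
  have hlam : ∑ x with c.φ (c.src x) = ⊥, c.ω x = d := by
    have h := congrArg Multiset.sum c.ends_lam
    rw [lam.parts_sum] at h
    exact h
  have h1 : ∑ x with U (c.src x), c.ω x =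
      ∑ x with U (c.src x) ∧ c.IsLeaf (c.src x), c.ω x +
        ∑ x with W (c.src x), c.ω x := by
    rw [← Finset.sum_filter_add_sum_filter_not _ (fun x => c.IsLeaf (c.src x)),
      Finset.filter_filter, Finset.filter_filter]
    simp only [not_isLeaf_iff, hW]
  have h2 : ∑ x with U (c.src x) ∧ c.IsLeaf (c.src x), c.ω x ≤ d := by
    refine le_of_le_of_eq (Finset.sum_le_sum_of_subset fun x hx => ?_) hlam
    simp only [Finset.mem_filter, Finset.mem_univ, true_and] at hx ⊢
    exact (c.isLeaf_src_iff x).1 hx.2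
  have h3 : ∑ x with W (c.src x), c.ω x =
      ∑ x with W (c.tgt x), c.ω x := by
    rw [hsum c.src W, hsum c.tgt W]
    exact Finset.sum_congr rfl fun v hv =>
      (c.balanced v ((hW v).1 (Finset.mem_filter.1 hv).2).2).symm
  -- An edge ending below the cut also starts there, whereas `e` starts below the cut but ends above
  -- it.
  have h4 : ∑ x with W (c.tgt x), c.ω x + c.ω e ≤
      ∑ x with U (c.src x), c.ω x := by
    rw [← Finset.sum_singleton c.ω e, ← Finset.sum_union]
    · refine Finset.sum_le_sum_of_subset fun x hx => ?_
      simp only [Finset.mem_union, Finset.mem_filter, Finset.mem_univ, true_and,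
        Finset.mem_singleton] at hx ⊢
      rcases hx with hx | rfl
      · exact (c.φ_lt x).le.trans ((hW _).1 hx).1
      · exact le_rfl
    · rw [Finset.disjoint_singleton_right]
      simp only [Finset.mem_filter, Finset.mem_univ, true_and]
      exact fun h => absurd ((hW _).1 h).1 (not_le.2 (c.φ_lt e))
  omega

end TropicalCover

/-! ### Finiteness of the set of isomorphism classes -/

namespace TropicalCover

variable {d s t g : ℕ} {lam mu : Nat.Partition d} {z : Distribution s t}

/-- The possible values of a cover at the vertices. -/
def vertexValues (z : Distribution s t) : Set EReal :=
  {⊥, ⊤} ∪ Set.range fun k => ((z.point k : ℝ) : EReal)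

instance : Finite (vertexValues z) :=
  ((Set.toFinite {⊥, ⊤}).union (Set.finite_range _)).to_subtype

theorem φ_mem_vertexValues (c : TropicalCover g lam mu z) (v : c.V) :
    c.φ v ∈ vertexValues z := by
  rcases c.isLeaf_or_isInner v with h | h
  · exact Or.inl (c.leaf v h)
  · obtain ⟨k, hk⟩ := c.exists_point_of_isInner h
    exact Or.inr ⟨k, hk.symm⟩

/-- The combinatorial data of a cover with vertices and edges numbered by `eV` and `eE`. -/
def code (c : TropicalCover g lam mu z) {n m : ℕ} (eV : c.V ≃ Fin n) (eE : c.E ≃ Fin m) :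
    (Fin m → Fin n) × (Fin m → Fin n) × (Fin n → vertexValues z) × (Fin m → Fin (d + 1)) :=
  (fun x => eV (c.src (eE.symm x)), fun x => eV (c.tgt (eE.symm x)),
    fun v => ⟨c.φ (eV.symm v), c.φ_mem_vertexValues _⟩,
    fun x => ⟨c.ω (eE.symm x), Nat.lt_succ_of_le (c.ω_le _)⟩)

theorem nonempty_iso_of_code_eq {c c' : TropicalCover g lam mu z} {n m : ℕ}
    (eV : c.V ≃ Fin n) (eE : c.E ≃ Fin m) (eV' : c'.V ≃ Fin n) (eE' : c'.E ≃ Fin m)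
    (h : c.code eV eE = c'.code eV' eE') : Nonempty (Iso c c') := by
  simp only [code, Prod.mk.injEq] at h
  obtain ⟨h1, h2, h3, h4⟩ := h
  refine ⟨Iso.mk' (eV.trans eV'.symm) (eE.trans eE'.symm) (fun e => ?_) (fun e => ?_)
    (fun v => ?_) (fun e => ?_)⟩
  · have := congrFun h1 (eE e)
    simp only [Equiv.symm_apply_apply] at this
    simp [this]
  · have := congrFun h2 (eE e)
    simp only [Equiv.symm_apply_apply] at this
    simp [this]
  · have := congrArg Subtype.val (congrFun h3 (eV v))
    simp only [Equiv.symm_apply_apply] at this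
    simp [this]
  · have := congrArg Fin.val (congrFun h4 (eE e))
    simp only [Equiv.symm_apply_apply] at this
    simp [this]

/-- There are only finitely many isomorphism classes of tropical covers. -/
theorem finite_classes
    (hst : 2 * s + t + 2 = Multiset.card lam.parts + Multiset.card mu.parts + 2 * g)
    (P : TropicalCover g lam mu z → Prop) :
    Finite (Quotient ((isoSetoid g lam mu z).comap (Subtype.val : {c // P c} → _))) := by
  -- Vertex and edge numbers depend only on the type of the cover, so all codes lie in one finite
  -- type.
  let f (q : Quotient ((isoSetoid g lam mu z).comap (Subtype.val : {c // P c} → _))) :=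
    q.out.1.code (Fintype.equivFinOfCardEq (q.out.1.card_V hst))
      (Fintype.equivFinOfCardEq (q.out.1.card_E hst))
  refine Finite.of_injective f fun q q' h => ?_
  rw [← q.out_eq, ← q'.out_eq]
  exact Quotient.sound (nonempty_iso_of_code_eq _ _ _ _ h)

end TropicalCover

/-! ### Moving the branch points -/

section Move

variable {s t : ℕ} (z z' : Distribution s t)

open Classical in
/-- The map that moves the points of `z` to the corresponding points of `z'` and fixes all other
points. -/
noncomputable def movePoints (x : EReal) : EReal :=
  if h : ∃ k, x = ((z.point k : ℝ) : EReal) then ((z'.point h.choose : ℝ) : EReal) else x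

theorem movePoints_point (k) :
    movePoints z z' ((z.point k : ℝ) : EReal) = ((z'.point k : ℝ) : EReal) := by
  have h : ∃ l, ((z.point k : ℝ) : EReal) = ((z.point l : ℝ) : EReal) := ⟨k, rfl⟩
  rw [movePoints, dif_pos h, ← z.point_injective (EReal.coe_injective h.choose_spec)]

theorem movePoints_lo (k) :
    movePoints z z' ((z.lo k : ℝ) : EReal) = ((z'.lo k : ℝ) : EReal) :=
  movePoints_point z z' (Sum.inl (Sum.inl k))

theorem movePoints_hi (k) :
    movePoints z z' ((z.hi k : ℝ) : EReal) = ((z'.hi k : ℝ) : EReal) :=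
  movePoints_point z z' (Sum.inl (Sum.inr k))

theorem movePoints_y (k) :
    movePoints z z' ((z.y k : ℝ) : EReal) = ((z'.y k : ℝ) : EReal) :=
  movePoints_point z z' (Sum.inr k)

@[simp] theorem movePoints_bot : movePoints z z' ⊥ = ⊥ := by
  rw [movePoints, dif_neg (by simp)]

@[simp] theorem movePoints_top : movePoints z z' ⊤ = ⊤ := by
  rw [movePoints, dif_neg (by simp)]

/-- Moving back undoes the move on all values that a cover takes at vertices. This is why statements
about positions can be transferred in both directions. -/
theorem movePoints_movePoints {x : EReal} (hx : x ∈ TropicalCover.vertexValues z) :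
    movePoints z' z (movePoints z z' x) = x := by
  rcases hx with (rfl | rfl) | ⟨k, rfl⟩
  · simp
  · simp
  · simp only [movePoints_point]

theorem movePoints_injOn : Set.InjOn (movePoints z z') (TropicalCover.vertexValues z) :=
  fun x hx y hy h => by
    rw [← movePoints_movePoints z z' hx, h, movePoints_movePoints z z' hy]

/-- The order among members of pairs depends only on their indices, hence agrees for any two
distributions. -/
theorem Distribution.lo_lt_hi_iff {i j : Fin s} : z.lo i < z.hi j ↔ i ≤ j := by
  refine ⟨fun h => le_of_not_gt fun h' => ?_, fun h => ?_⟩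
  · exact (h.trans (z.hi_lt_lo j i h')).false
  · exact (z.lo_strictMono.monotone h).trans_lt (z.lo_lt_hi j)

theorem Distribution.hi_lt_lo_iff {i j : Fin s} : z.hi i < z.lo j ↔ i < j := by
  refine ⟨fun h => lt_of_not_ge fun h' => ?_, z.hi_lt_lo i j⟩
  exact (h.trans ((z.lo_lt_hi_iff).2 h')).false

/-- Both are `±∞`, or both are members of pairs, or both are single points. -/
def SameKind (x y : EReal) : Prop :=
  x = ⊥ ∨ y = ⊤ ∨ (∃ r ∈ z.pairPoints, x = ((r : ℝ) : EReal)) ∧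
      (∃ r ∈ z.pairPoints, y = ((r : ℝ) : EReal)) ∨
    (∃ r ∈ z.singlePoints, x = ((r : ℝ) : EReal)) ∧
      (∃ r ∈ z.singlePoints, y = ((r : ℝ) : EReal))

/-- Within one kind the order is read off from the indices, which the move preserves. Between a pair
and a single point the order may be reversed, so `SameKind` cannot be dropped. -/
theorem movePoints_lt {x y : EReal} (hx : x ∈ TropicalCover.vertexValues z)
    (hy : y ∈ TropicalCover.vertexValues z) (h : x < y) (hxy : SameKind z x y) :
    movePoints z z' x < movePoints z z' y := by
  rcases hxy with rfl | rfl | ⟨⟨r, hr, rfl⟩, ⟨r', hr', rfl⟩⟩ | ⟨⟨r, hr, rfl⟩, ⟨r', hr', rfl⟩⟩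
  · rcases hy with (rfl | rfl) | ⟨k, rfl⟩
    · exact absurd h (lt_irrefl _)
    · simp
    · simp [movePoints_point]
  · rcases hx with (rfl | rfl) | ⟨k, rfl⟩
    · simp
    · exact absurd h (lt_irrefl _)
    · simp [movePoints_point]
  · rw [EReal.coe_lt_coe_iff] at h
    rcases hr with ⟨k, rfl⟩ | ⟨k, rfl⟩ <;> rcases hr' with ⟨l, rfl⟩ | ⟨l, rfl⟩ <;>
      simp only [movePoints_lo, movePoints_hi, EReal.coe_lt_coe_iff]
    · exact z'.lo_strictMono (z.lo_strictMono.lt_iff_lt.1 h)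
    · exact z'.lo_lt_hi_iff.2 (z.lo_lt_hi_iff.1 h)
    · exact z'.hi_lt_lo_iff.2 (z.hi_lt_lo_iff.1 h)
    · exact z'.hi_strictMono (z.hi_strictMono.lt_iff_lt.1 h)
  · rw [EReal.coe_lt_coe_iff] at h
    obtain ⟨k, rfl⟩ := hr
    obtain ⟨l, rfl⟩ := hr'
    simp only [movePoints_y, EReal.coe_lt_coe_iff]
    exact z'.y_strictMono (z.y_strictMono.lt_iff_lt.1 h)

end Move

namespace TropicalCover

variable {d s t g : ℕ} {lam mu : Nat.Partition d} {z z' : Distribution s t}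
variable (c : TropicalCover g lam mu z)

theorem movePoints_eq_lo {v : c.V} {k : Fin s} :
    movePoints z z' (c.φ v) = ((z'.lo k : ℝ) : EReal) ↔ c.φ v = ((z.lo k : ℝ) : EReal) := by
  rw [← movePoints_lo z z', (movePoints_injOn z z').eq_iff (c.φ_mem_vertexValues v)]
  exact Or.inr ⟨Sum.inl (Sum.inl k), rfl⟩

theorem movePoints_eq_hi {v : c.V} {k : Fin s} :
    movePoints z z' (c.φ v) = ((z'.hi k : ℝ) : EReal) ↔ c.φ v = ((z.hi k : ℝ) : EReal) := by
  rw [← movePoints_hi z z', (movePoints_injOn z z').eq_iff (c.φ_mem_vertexValues v)]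
  exact Or.inr ⟨Sum.inl (Sum.inr k), rfl⟩

theorem movePoints_eq_bot {v : c.V} : movePoints z z' (c.φ v) = ⊥ ↔ c.φ v = ⊥ := by
  conv_lhs => rw [← movePoints_bot z z']
  exact (movePoints_injOn z z').eq_iff (c.φ_mem_vertexValues v) (Or.inl (Or.inl rfl))

theorem movePoints_eq_top {v : c.V} : movePoints z z' (c.φ v) = ⊤ ↔ c.φ v = ⊤ := by
  conv_lhs => rw [← movePoints_top z z']
  exact (movePoints_injOn z z').eq_iff (c.φ_mem_vertexValues v) (Or.inl (Or.inr rfl))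

/-! ### Rewiring a cover -/

open Classical in
/-- New edge data for a cover: the starting points and the end points of the edges are permuted and
the weights are changed, in such a way that the result can be mapped to `ℝ ∪ {±∞}` with branch
points `z'`. -/
structure Rewiring (z' : Distribution s t) where
  σ : Equiv.Perm c.E
  τ : Equiv.Perm c.E
  ω : c.E → ℕ
  ω_pos : ∀ e, 0 < ω e
  φ_lt : ∀ e, movePoints z z' (c.φ (c.src (σ e))) < movePoints z z' (c.φ (c.tgt (τ e)))
  connected : ∀ u v, Relation.EqvGen (fun a b => ∃ e, c.src (σ e) = a ∧ c.tgt (τ e) = b) u v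
  balanced : ∀ v, c.IsInner v →
    ∑ e with c.tgt (τ e) = v, ω e = ∑ e with c.src (σ e) = v, ω e
  ends_lam : (Finset.univ.filter (fun e => c.φ (c.src (σ e)) = ⊥)).val.map ω = lam.parts
  ends_mu : (Finset.univ.filter (fun e => c.φ (c.tgt (τ e)) = ⊤)).val.map ω = mu.parts

variable {c}

/-- Permuting sources and targets separately changes no in- or out-degree; this is the reason for
encoding a rewiring by two permutations. Leaves and inner vertices stay the same, and so does the
genus, as no vertex or edge is added. -/
theorem ncard_perm {α β : Type*} (f : α → β) (σ : Equiv.Perm α) (v : β) :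
    {e | f (σ e) = v}.ncard = {e | f e = v}.ncard := by
  rw [← Set.ncard_image_of_injective _ σ.injective]
  congr 1
  ext x
  constructor
  · rintro ⟨y, hy, rfl⟩
    exact hy
  · exact fun hx => ⟨σ.symm x, by simpa using hx, by simp⟩

open Classical in
/-- The curve obtained by rewiring. -/
@[reducible] noncomputable def Rewiring.curve (R : c.Rewiring z') : TropicalCurve where
  V := c.V
  E := c.E
  src e := c.src (R.σ e)
  tgt e := c.tgt (R.τ e)
  -- The length on an inner edge is forced: the distance of the new endpoints in the target divided
  -- by the slope.
  len e := if c.IsLeaf (c.src (R.σ e)) ∨ c.IsLeaf (c.tgt (R.τ e)) then ⊤ else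
    ENNReal.ofReal (((movePoints z z' (c.φ (c.tgt (R.τ e)))).toReal -
      (movePoints z z' (c.φ (c.src (R.σ e)))).toReal) / R.ω e)
  len_pos e := by
    split_ifs with h
    · simp
    · rw [ENNReal.ofReal_pos]
      push Not at h
      obtain ⟨k, hk⟩ := c.exists_point_of_isInner (c.not_isLeaf_iff.1 h.1)
      obtain ⟨l, hl⟩ := c.exists_point_of_isInner (c.not_isLeaf_iff.1 h.2)
      have := R.φ_lt e
      rw [hk, hl, movePoints_point, movePoints_point, EReal.coe_lt_coe_iff] at this
      rw [hk, hl, movePoints_point, movePoints_point, EReal.toReal_coe, EReal.toReal_coe]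
      have h2 := R.ω_pos e
      have : (0 : ℝ) < R.ω e := by exact_mod_cast h2
      apply div_pos _ this
      linarith
  valence_eq v := by
    rw [ncard_perm c.src, ncard_perm c.tgt]
    exact c.valence_eq v
  len_eq_top e := by
    rw [ncard_perm c.src, ncard_perm c.tgt, ncard_perm c.src, ncard_perm c.tgt]
    split_ifs with h
    · exact ⟨fun _ => h, fun _ => rfl⟩
    · exact ⟨fun h' => absurd h' ENNReal.ofReal_ne_top, fun h' => absurd h' h⟩
  nonempty := c.nonempty
  connected := R.connected

theorem Rewiring.isLeaf_iff (R : c.Rewiring z') (v : c.V) :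
    R.curve.IsLeaf v ↔ c.IsLeaf v := by
  unfold TropicalCurve.IsLeaf TropicalCurve.valence
  rw [ncard_perm c.src, ncard_perm c.tgt]

theorem Rewiring.isInner_iff (R : c.Rewiring z') (v : c.V) :
    R.curve.IsInner v ↔ c.IsInner v := by
  unfold TropicalCurve.IsInner TropicalCurve.valence
  rw [ncard_perm c.src, ncard_perm c.tgt]

open Classical in
/-- The cover obtained by rewiring. -/
@[reducible] noncomputable def Rewiring.cover (R : c.Rewiring z') : TropicalCover g lam mu z' where
  toTropicalCurve := R.curve
  genus_eq := c.genus_eq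
  φ v := movePoints z z' (c.φ v)
  ω := R.ω
  ω_pos := R.ω_pos
  φ_lt := R.φ_lt
  slope e he := by
    have h : ¬ (c.IsLeaf (c.src (R.σ e)) ∨ c.IsLeaf (c.tgt (R.τ e))) := by
      intro h
      exact he (by simp only [if_pos h])
    have h0 := R.curve.len_pos e
    simp only [if_neg h] at h0 ⊢
    push Not at h
    obtain ⟨k, hk⟩ := c.exists_point_of_isInner (c.not_isLeaf_iff.1 h.1)
    obtain ⟨l, hl⟩ := c.exists_point_of_isInner (c.not_isLeaf_iff.1 h.2)
    rw [ENNReal.ofReal_pos] at h0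
    rw [ENNReal.toReal_ofReal h0.le, mul_div_cancel₀ _ (by exact_mod_cast (R.ω_pos e).ne')]
    rw [hk, hl, movePoints_point, movePoints_point, EReal.toReal_coe, EReal.toReal_coe,
      ← EReal.coe_add]
    congr 1
    ring
  image_inner := by
    simp only [R.isInner_iff]
    rw [← z'.range_point, ← Set.range_comp]
    have h : (fun v => movePoints z z' (c.φ v)) '' {v | c.IsInner v} =
        movePoints z z' '' (c.φ '' {v | c.IsInner v}) := by rw [Set.image_image]
    rw [h, c.image_inner_eq_range, ← Set.range_comp]
    congr 1
    funext k
    exact movePoints_point z z' k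
  leaf v hv := by
    rw [R.isLeaf_iff] at hv
    rw [movePoints_eq_bot, movePoints_eq_top]
    exact c.leaf v hv
  balanced v hv := R.balanced v ((R.isInner_iff v).1 hv)
  ends_lam := by
    simp only [movePoints_eq_bot]
    exact R.ends_lam
  ends_mu := by
    simp only [movePoints_eq_top]
    exact R.ends_mu

theorem Rewiring.isContractible_iff (R : c.Rewiring z') (e : c.E) :
    R.cover.IsContractible e ↔ ∃ k : Fin s, c.φ (c.src (R.σ e)) = (z.lo k : EReal) ∧
      c.φ (c.tgt (R.τ e)) = (z.hi k : EReal) := by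
  unfold IsContractible
  simp only [movePoints_eq_lo, movePoints_eq_hi]

theorem Rewiring.isEnd_iff (R : c.Rewiring z') (e : c.E) :
    R.curve.IsEnd e ↔ c.IsLeaf (c.src (R.σ e)) ∨ c.IsLeaf (c.tgt (R.τ e)) := by
  unfold TropicalCurve.IsEnd
  rw [R.isLeaf_iff, R.isLeaf_iff]

end TropicalCover

/-- A single step may go to a whole chain; this is needed where a rewired edge is replaced by a
path, or where `f` collapses vertices. -/
theorem eqvGen_map {α β : Type*} {r : α → α → Prop} {p : β → β → Prop} (f : α → β)
    (h : ∀ a b, r a b → Relation.EqvGen p (f a) (f b)) {a b : α} (hab : Relation.EqvGen r a b) :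
    Relation.EqvGen p (f a) (f b) := by
  induction hab with
  | rel a b hab => exact h a b hab
  | refl a => exact .refl _
  | symm a b _ ih => exact .symm _ _ ih
  | trans a b c _ _ h1 h2 => exact .trans _ _ _ h1 h2

/-! ### What a rewiring preserves away from the edges it changes -/

namespace TropicalCover

variable {d s t g : ℕ} {lam mu : Nat.Partition d} {z z' : Distribution s t}
variable {c : TropicalCover g lam mu z} (R : c.Rewiring z')

/-- The edge `e` keeps its endpoints and its weight. -/
def Rewiring.Fixes (e : c.E) : Prop :=
  c.src (R.σ e) = c.src e ∧ c.tgt (R.τ e) = c.tgt e ∧ R.ω e = c.ω e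

variable {R}

theorem Rewiring.Fixes.joins {e : c.E} (h : R.Fixes e) {u v : c.V} (hj : c.Joins e u v) :
    R.curve.Joins e u v := by
  unfold TropicalCurve.Joins at *
  simp only [h.1, h.2.1]
  exact hj

theorem Rewiring.Fixes.isEnd_iff {e : c.E} (h : R.Fixes e) : R.curve.IsEnd e ↔ c.IsEnd e := by
  rw [R.isEnd_iff, h.1, h.2.1]
  rfl

theorem isSymCycle_iff {p : Set c.E} (hp : ∀ e ∈ p, R.Fixes e) :
    R.cover.IsSymCycle p ↔ c.IsSymCycle p := by
  unfold IsSymCycle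
  refine exists_congr fun a => exists_congr fun b => and_congr_right fun _ =>
    and_congr_right fun h => ?_
  have ha := hp a (by simp [h])
  have hb := hp b (by simp [h])
  simp only [ha.isEnd_iff, hb.isEnd_iff, ha.1, hb.1, ha.2.1, hb.2.1, ha.2.2, hb.2.2]

theorem isSymFork_iff {p : Set c.E} (hp : ∀ e ∈ p, R.Fixes e) :
    R.cover.IsSymFork p ↔ c.IsSymFork p := by
  unfold IsSymFork
  refine exists_congr fun a => exists_congr fun b => and_congr_right fun _ =>
    and_congr_right fun h => ?_
  have ha := hp a (by simp [h])
  have hb := hp b (by simp [h])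
  simp only [ha.isEnd_iff, hb.isEnd_iff, TropicalCurve.Incident, ha.1, hb.1, ha.2.1, hb.2.1,
    ha.2.2, hb.2.2, R.isInner_iff]

theorem IsTail.rewire {v : c.V} {vs : Set c.V} {es : Set c.E} (h : c.IsTail v vs es)
    (hes : ∀ e ∈ es, R.Fixes e) : R.cover.IsTail v vs es := by
  induction h with
  | leaf v u e hj hu he =>
    have h := hes e rfl
    refine IsTail.leaf (c := R.cover) v u e (h.joins hj) ((R.isLeaf_iff u).2 hu) ?_
    change Even (R.ω e)
    rw [h.2.2]
    exact he
  | fork v u x x' e a b hj ha hb hea heb hu hx hx' hs =>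
    have h1 := hes e (by simp)
    have h2 := hes a (by simp)
    have h3 := hes b (by simp)
    refine IsTail.fork (c := R.cover) v u x x' e a b (h1.joins hj) (h2.joins ha) (h3.joins hb)
      hea heb ((R.isInner_iff u).2 hu) ((R.isLeaf_iff x).2 hx) ((R.isLeaf_iff x').2 hx') ?_
    refine (isSymFork_iff ?_).2 hs
    rintro y (rfl | rfl) <;> assumption
  | cycle v u u' e a b vs es hj ha hb hea heb hs ho ht hae hbe ih =>
    have h1 := hes e (by simp)
    have h2 := hes a (by simp)
    have h3 := hes b (by simp)
    refine IsTail.cycle (c := R.cover) v u u' e a b vs es (h1.joins hj) (h2.joins ha)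
      (h3.joins hb) hea heb ?_ ?_ (ih fun e he => hes e (Or.inr he)) hae hbe
    · refine (isSymCycle_iff ?_).2 hs
      rintro y (rfl | rfl) <;> assumption
    · change Odd (R.ω a)
      rw [h2.2.2]
      exact ho

/-- Each picture involves only edges at `v` or `v'`, so a rewiring elsewhere cannot disturb it. -/
theorem pictures_rewire {v v' : c.V} (hf : ∀ e, c.Incident e v ∨ c.Incident e v' → R.Fixes e)
    (h : c.PictureJoin v v' ∨ c.PictureSplit v v' ∨ (∃ i f e j, c.PictureCross v v' i f e j) ∨
      c.PictureCycle v v') :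
    R.cover.PictureJoin v v' ∨ R.cover.PictureSplit v v' ∨
      (∃ i f e j, R.cover.PictureCross v v' i f e j) ∨ R.cover.PictureCycle v v' := by
  rcases h with h | h | h | h
  · left
    obtain ⟨a, b, e, f, hab, hef, ha, hb, he, he', hf', hω, hs⟩ := h
    have fa := hf a (Or.inl (Or.inr ha))
    have fb := hf b (Or.inl (Or.inr hb))
    have fe := hf e (Or.inl (Or.inl he))
    have ff := hf f (Or.inr (Or.inr hf'))
    have fab : ∀ y ∈ ({a, b} : Set c.E), R.Fixes y := by
      rintro y (rfl | rfl) <;> assumption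
    exact ⟨a, b, e, f, hab, hef, fa.2.1.trans ha, fb.2.1.trans hb, fe.1.trans he,
      fe.2.1.trans he', ff.2.1.trans hf', (fa.2.2.trans hω).trans fb.2.2.symm,
      hs.imp (isSymCycle_iff fab).2 (isSymFork_iff fab).2⟩
  · right; left
    obtain ⟨a, b, e, f, hab, hef, ha, hb, he, he', hf', hω, hs⟩ := h
    have fa := hf a (Or.inr (Or.inl ha))
    have fb := hf b (Or.inr (Or.inl hb))
    have fe := hf e (Or.inl (Or.inl he))
    have ff := hf f (Or.inl (Or.inl hf'))
    have fab : ∀ y ∈ ({a, b} : Set c.E), R.Fixes y := by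
      rintro y (rfl | rfl) <;> assumption
    exact ⟨a, b, e, f, hab, hef, fa.1.trans ha, fb.1.trans hb, fe.1.trans he,
      fe.2.1.trans he', ff.1.trans hf', (fa.2.2.trans hω).trans fb.2.2.symm,
      hs.imp (isSymCycle_iff fab).2 (isSymFork_iff fab).2⟩
  · right; right; left
    obtain ⟨i, f, e, j, hi, hf', he, he', hj, hfe, hje, hfj⟩ := h
    have fi := hf i (Or.inl (Or.inr hi))
    have ff := hf f (Or.inl (Or.inl hf'))
    have fe := hf e (Or.inl (Or.inl he))
    have fj := hf j (Or.inr (Or.inr hj))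
    exact ⟨i, f, e, j, fi.2.1.trans hi, ff.1.trans hf', fe.1.trans he, fe.2.1.trans he',
      fj.2.1.trans hj, hfe, hje, hfj⟩
  · right; right; right
    obtain ⟨a, b, hab, ha, ha', hb, hb', h⟩ := h
    have fa := hf a (Or.inl (Or.inl ha))
    have fb := hf b (Or.inl (Or.inl hb))
    refine ⟨a, b, hab, fa.1.trans ha, fa.2.1.trans ha', fb.1.trans hb, fb.2.1.trans hb', ?_⟩
    change Even (R.ω a) ∨ Even (R.ω b)
    rw [fa.2.2, fb.2.2]
    exact h

/-- Elements of `Sym_2` that consist of fixed edges were in `Sym_2` before the rewiring, if the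
contractible edges are the same and have the same endpoints. -/
theorem mem_sym2_of_rewire
    (hR : ∀ e, c.IsContractible e → c.src (R.σ e) = c.src e ∧ c.tgt (R.τ e) = c.tgt e)
    {p : Set c.E} (hp : ∀ e ∈ p, R.Fixes e) (h : p ∈ R.cover.sym2) : p ∈ c.sym2 := by
  have hcon : ∀ e, c.IsContractible e → R.cover.IsContractible e := by
    rintro e he
    rw [R.isContractible_iff, (hR e he).1, (hR e he).2]
    exact he
  obtain ⟨⟨h1, h2⟩, h3⟩ := h
  refine ⟨⟨h1.imp (isSymCycle_iff hp).1 (isSymFork_iff hp).1, fun a ha h => h2 a ha (hcon a h)⟩, ?_⟩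
  rintro ⟨a, ha, e, v, he, hav, hev⟩
  refine h3 ⟨a, ha, e, v, hcon e he, ?_, ?_⟩
  · unfold TropicalCurve.Incident at *
    rw [(hp a ha).1, (hp a ha).2.1]
    exact hav
  · unfold TropicalCurve.Incident at *
    rw [(hR e he).1, (hR e he).2]
    exact hev

/-- Moving the branch points without rewiring preserves generalized zigzag covers. -/
theorem IsGenZigzag.rewire (h : c.IsGenZigzag) (hR : ∀ e, R.Fixes e) : R.cover.IsGenZigzag := by
  have hcon : ∀ e, R.cover.IsContractible e ↔ c.IsContractible e := by
    intro e
    rw [R.isContractible_iff, (hR e).1, (hR e).2.1]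
    rfl
  obtain ⟨hres, VS, ES, hc⟩ := h
  refine ⟨fun k => ?_, VS, ES, ?_⟩
  · obtain ⟨v, v', hv, hv', h1, h2, h3⟩ := hres k
    exact ⟨v, v', (R.isInner_iff v).2 hv, (R.isInner_iff v').2 hv', c.movePoints_eq_lo.2 h1,
      c.movePoints_eq_hi.2 h2, pictures_rewire (fun e _ => hR e) h3⟩
  · refine ⟨fun e he => ?_, fun u hu v hv => ?_, fun p hp e he => ?_, fun e he => ?_, ?_,
      fun e he hev => ?_, fun u hu => ?_, fun e he => ?_⟩
    · rw [(hR e).1, (hR e).2.1]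
      exact hc.closed e he
    · refine eqvGen_map id ?_ (hc.connected u hu v hv)
      rintro a b ⟨e, he, h1, h2⟩
      exact .rel _ _ ⟨e, he, (hR e).1.trans h1, (hR e).2.1.trans h2⟩
    · rw [(hR e).1, (hR e).2.1]
      exact hc.disjoint_sym2 p (mem_sym2_of_rewire (R := R)
        (fun e _ => ⟨(hR e).1, (hR e).2.1⟩) (fun e _ => hR e) hp) e he
    · exact hc.contractible e ((hcon e).1 he)
    · obtain ⟨v, hv, h⟩ := hc.inner
      exact ⟨v, hv, (R.isInner_iff v).2 h⟩
    · change Even (R.ω e) at hev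
      rw [(hR e).2.2] at hev
      exact (hcon e).2 (hc.even e he hev)
    · obtain ⟨v, hv, vs, es, ht, h⟩ := hc.tails.1 u hu
      exact ⟨v, hv, vs, es, ht.rewire fun e _ => hR e, h⟩
    · obtain ⟨v, hv, vs, es, ht, h⟩ := hc.tails.2 e he
      exact ⟨v, hv, vs, es, ht.rewire fun e _ => hR e, h⟩

theorem nonempty_iso_of_rewire_fixes {c₁ c₂ : TropicalCover g lam mu z} {R₁ : c₁.Rewiring z'}
    {R₂ : c₂.Rewiring z'} (h₁ : ∀ e, R₁.Fixes e) (h₂ : ∀ e, R₂.Fixes e)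
    (F : Iso R₁.cover R₂.cover) : Nonempty (Iso c₁ c₂) := by
  refine ⟨Iso.mk' (c := c₁) (c' := c₂) F.vert F.edge (fun e => ?_) (fun e => ?_) (fun v => ?_)
    fun e => ?_⟩
  · have := F.src_eq e
    simp only [(h₁ _).1, (h₂ _).1] at this
    exact this
  · have := F.tgt_eq e
    simp only [(h₁ _).2.1, (h₂ _).2.1] at this
    exact this
  · exact movePoints_injOn z z' (c₂.φ_mem_vertexValues _) (c₁.φ_mem_vertexValues _) (F.φ_eq v)
  · have := F.ω_eq e
    simp only [(h₁ _).2.2, (h₂ _).2.2] at this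
    exact this

end TropicalCover

namespace TropicalCover

variable {d s t g : ℕ} {lam mu : Nat.Partition d} {z : Distribution s t}
variable (c : TropicalCover g lam mu z)

/-! ### Local structure at an inner vertex -/

theorem eq_of_two_incoming {v : c.V} (hv : c.IsInner v) {a b : c.E} (hab : a ≠ b)
    (ha : c.tgt a = v) (hb : c.tgt b = v) :
    ∃ h, (∀ x, c.tgt x = v ↔ x = a ∨ x = b) ∧ (∀ x, c.src x = v ↔ x = h) ∧
      c.ω h = c.ω a + c.ω b := by
  classical
  have hval := hv
  unfold TropicalCurve.IsInner at hval
  rw [c.valence_eq_card] at hval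
  have hbal := c.balanced v hv
  have hsub : ({a, b} : Finset c.E) ⊆ Finset.univ.filter fun e => c.tgt e = v := by
    intro x hx
    simp only [Finset.mem_insert, Finset.mem_singleton] at hx
    rcases hx with rfl | rfl <;> simpa
  have hcard := Finset.card_le_card hsub
  rw [Finset.card_pair hab] at hcard
  -- Weights are positive, so balancing excludes a vertex with incoming edges only; valence three
  -- then leaves exactly one outgoing edge.
  have hpos : (Finset.univ.filter fun e => c.src e = v).card ≠ 0 := by
    intro h0
    rw [Finset.card_eq_zero] at h0
    have h1 : c.ω a ≤ ∑ e with c.tgt e = v, c.ω e :=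
      Finset.single_le_sum (f := c.ω) (fun _ _ => Nat.zero_le _) (hsub (by simp))
    have h2 := c.ω_pos a
    have h3 : ∑ e with c.src e = v, c.ω e = 0 := by rw [h0]; rfl
    omega
  have heq := Finset.eq_of_subset_of_card_le hsub (by rw [Finset.card_pair hab]; omega)
  obtain ⟨h, hh⟩ := Finset.card_eq_one.1
    (show (Finset.univ.filter fun e => c.src e = v).card = 1 by omega)
  refine ⟨h, fun x => ?_, fun x => ?_, ?_⟩
  · have := Finset.ext_iff.1 heq x
    simpa using this.symm
  · have := Finset.ext_iff.1 hh x
    simpa using this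
  · have h1 : ∑ e with c.src e = v, c.ω e = c.ω h := by rw [hh, Finset.sum_singleton]
    have h2 : ∑ e with c.tgt e = v, c.ω e = c.ω a + c.ω b := by rw [← heq, Finset.sum_pair hab]
    omega

theorem eq_of_two_outgoing {v : c.V} (hv : c.IsInner v) {a b : c.E} (hab : a ≠ b)
    (ha : c.src a = v) (hb : c.src b = v) :
    ∃ h, (∀ x, c.src x = v ↔ x = a ∨ x = b) ∧ (∀ x, c.tgt x = v ↔ x = h) ∧
      c.ω h = c.ω a + c.ω b := by
  classical
  have hval := hv
  unfold TropicalCurve.IsInner at hval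
  rw [c.valence_eq_card] at hval
  have hbal := c.balanced v hv
  have hsub : ({a, b} : Finset c.E) ⊆ Finset.univ.filter fun e => c.src e = v := by
    intro x hx
    simp only [Finset.mem_insert, Finset.mem_singleton] at hx
    rcases hx with rfl | rfl <;> simpa
  have hcard := Finset.card_le_card hsub
  rw [Finset.card_pair hab] at hcard
  have hpos : (Finset.univ.filter fun e => c.tgt e = v).card ≠ 0 := by
    intro h0
    rw [Finset.card_eq_zero] at h0
    have h1 : c.ω a ≤ ∑ e with c.src e = v, c.ω e :=
      Finset.single_le_sum (f := c.ω) (fun _ _ => Nat.zero_le _) (hsub (by simp))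
    have h2 := c.ω_pos a
    have h3 : ∑ e with c.tgt e = v, c.ω e = 0 := by rw [h0]; rfl
    omega
  have heq := Finset.eq_of_subset_of_card_le hsub (by rw [Finset.card_pair hab]; omega)
  obtain ⟨h, hh⟩ := Finset.card_eq_one.1
    (show (Finset.univ.filter fun e => c.tgt e = v).card = 1 by omega)
  refine ⟨h, fun x => ?_, fun x => ?_, ?_⟩
  · have := Finset.ext_iff.1 heq x
    simpa using this.symm
  · have := Finset.ext_iff.1 hh x
    simpa using this
  · have h1 : ∑ e with c.tgt e = v, c.ω e = c.ω h := by rw [hh, Finset.sum_singleton]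
    have h2 : ∑ e with c.src e = v, c.ω e = c.ω a + c.ω b := by rw [← heq, Finset.sum_pair hab]
    omega

/-- The weights of the three edges at an inner vertex have an even sum. -/
theorem even_sum_of_incident {v : c.V} (hv : c.IsInner v) {a b e : c.E} (hab : a ≠ b)
    (hea : e ≠ a) (heb : e ≠ b) (ha : c.Incident a v) (hb : c.Incident b v)
    (he : c.Incident e v) : Even (c.ω e + (c.ω a + c.ω b)) := by
  classical
  have hval := hv
  unfold TropicalCurve.IsInner at hval
  rw [c.valence_eq_card] at hval
  have hbal := c.balanced v hv
  have hdisj : Disjoint (Finset.univ.filter fun e => c.src e = v)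
      (Finset.univ.filter fun e => c.tgt e = v) := by
    rw [Finset.disjoint_filter]
    exact fun x _ h1 h2 => c.src_ne_tgt x (h1.trans h2.symm)
  have hsub : ({e, a, b} : Finset c.E) ⊆ (Finset.univ.filter fun e => c.src e = v) ∪
      (Finset.univ.filter fun e => c.tgt e = v) := by
    intro x hx
    simp only [Finset.mem_insert, Finset.mem_singleton] at hx
    simp only [Finset.mem_union, Finset.mem_filter, Finset.mem_univ, true_and]
    rcases hx with rfl | rfl | rfl <;> assumption
  have hcard : ({e, a, b} : Finset c.E).card = 3 := by
    rw [Finset.card_insert_of_notMem (by simp [hea, heb]), Finset.card_pair hab]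
  have heq := Finset.eq_of_subset_of_card_le hsub
    (by rw [Finset.card_union_of_disjoint hdisj, hcard, hval])
  have hsum : c.ω e + (c.ω a + c.ω b) = ∑ x ∈ ({e, a, b} : Finset c.E), c.ω x := by
    rw [Finset.sum_insert (by simp [hea, heb]), Finset.sum_pair hab]
  rw [hsum, heq, Finset.sum_union hdisj, hbal]
  exact ⟨_, rfl⟩

variable {c}

/-! ### Tails -/

theorem IsSymCycle.eq_pair {a b : c.E} (h : c.IsSymCycle {a, b}) :
    a ≠ b ∧ c.ω a = c.ω b ∧ ¬ c.IsEnd a ∧ ¬ c.IsEnd b := by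
  obtain ⟨a', b', hab, h1, h2, h3, h4, h5, h6⟩ := h
  rcases Set.pair_eq_pair_iff.1 h1 with ⟨rfl, rfl⟩ | ⟨rfl, rfl⟩
  · exact ⟨hab, h6, h2, h3⟩
  · exact ⟨hab.symm, h6.symm, h3, h2⟩

theorem IsSymFork.eq_pair {a b : c.E} (h : c.IsSymFork {a, b}) : a ≠ b ∧ c.ω a = c.ω b := by
  obtain ⟨a', b', hab, h1, h2, h3, h4, h5⟩ := h
  rcases Set.pair_eq_pair_iff.1 h1 with ⟨rfl, rfl⟩ | ⟨rfl, rfl⟩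
  · exact ⟨hab, h5⟩
  · exact ⟨hab.symm, h5.symm⟩

theorem Joins.incident {e : c.E} {u v : c.V} (h : c.Joins e u v) :
    c.Incident e u ∧ c.Incident e v := by
  unfold TropicalCurve.Joins at h
  unfold TropicalCurve.Incident
  tauto

theorem Joins.isInner {e : c.E} {u v : c.V} (h : c.Joins e u v) (he : ¬ c.IsEnd e) :
    c.IsInner u ∧ c.IsInner v := by
  rw [c.not_isEnd_iff] at he
  rcases h with ⟨rfl, rfl⟩ | ⟨rfl, rfl⟩
  · exact he
  · exact he.symm

/-- The endpoints of the edges of a tail are vertices of the tail or its starting point. -/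
theorem IsTail.endpoint_mem {v : c.V} {vs : Set c.V} {es : Set c.E} (h : c.IsTail v vs es) :
    ∀ x ∈ es, c.src x ∈ insert v vs ∧ c.tgt x ∈ insert v vs := by
  induction h with
  | leaf v u e hj hu he =>
    rintro x rfl
    rcases hj with ⟨h1, h2⟩ | ⟨h1, h2⟩ <;> simp [h1, h2]
  | fork v u x x' e a b hj ha hb hea heb hu hx hx' hs =>
    rintro y (rfl | rfl | rfl)
    · rcases hj with ⟨h1, h2⟩ | ⟨h1, h2⟩ <;> simp [h1, h2]
    · rcases ha with ⟨h1, h2⟩ | ⟨h1, h2⟩ <;> simp [h1, h2]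
    · rcases hb with ⟨h1, h2⟩ | ⟨h1, h2⟩ <;> simp [h1, h2]
  | cycle v u u' e a b vs es hj ha hb hea heb hs ho ht hae hbe ih =>
    rintro y ((rfl | rfl | rfl) | hy)
    · rcases hj with ⟨h1, h2⟩ | ⟨h1, h2⟩ <;> simp [h1, h2]
    · rcases ha with ⟨h1, h2⟩ | ⟨h1, h2⟩ <;> simp [h1, h2]
    · rcases hb with ⟨h1, h2⟩ | ⟨h1, h2⟩ <;> simp [h1, h2]
    · have := ih y hy
      simp only [Set.mem_insert_iff, Set.mem_union, Set.mem_singleton_iff] at this ⊢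
      tauto

/-- The odd edges of a tail do not meet its starting point. -/
theorem IsTail.endpoint_mem_of_odd {v : c.V} {vs : Set c.V} {es : Set c.E}
    (h : c.IsTail v vs es) : ∀ x ∈ es, Odd (c.ω x) → c.src x ∈ vs ∧ c.tgt x ∈ vs := by
  induction h with
  | leaf v u e hj hu he =>
    rintro x rfl hx
    exact absurd he (Nat.not_even_iff_odd.2 hx)
  | fork v u x x' e a b hj ha hb hea heb hu hx hx' hs =>
    rintro y (rfl | rfl | rfl) hy
    -- The constructor does not record that `e` is even; balancing does, because the other two edges
    -- at `u` have equal weight.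
    · have := c.even_sum_of_incident hu hs.eq_pair.1 hea heb (Joins.incident ha).1
        (Joins.incident hb).1 (Joins.incident hj).2
      rw [hs.eq_pair.2] at this
      grind
    · rcases ha with ⟨h1, h2⟩ | ⟨h1, h2⟩ <;> simp [h1, h2]
    · rcases hb with ⟨h1, h2⟩ | ⟨h1, h2⟩ <;> simp [h1, h2]
  | cycle v u u' e a b vs es hj ha hb hea heb hs ho ht hae hbe ih =>
    rintro y ((rfl | rfl | rfl) | hy) hodd
    · have := c.even_sum_of_incident (Joins.isInner ha hs.eq_pair.2.2.1).1 hs.eq_pair.1 hea heb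
        (Joins.incident ha).1 (Joins.incident hb).1 (Joins.incident hj).2
      rw [hs.eq_pair.2.1] at this
      grind
    · rcases ha with ⟨h1, h2⟩ | ⟨h1, h2⟩ <;> simp [h1, h2]
    · rcases hb with ⟨h1, h2⟩ | ⟨h1, h2⟩ <;> simp [h1, h2]
    · have := ih y hy hodd
      exact ⟨Or.inr this.1, Or.inr this.2⟩

/-- A tail that contains an end whose source does not belong to the tail consists of this end. -/
theorem IsTail.eq_of_end {v : c.V} {vs : Set c.V} {es : Set c.E} (h : c.IsTail v vs es)
    {x : c.E} (hx : x ∈ es) (hl : c.IsLeaf (c.tgt x)) (hs : c.src x ∉ vs) :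
    vs = {c.tgt x} ∧ es = {x} := by
  cases h with
  | leaf v u e hj hu he =>
    obtain rfl : x = e := hx
    rcases hj with ⟨h1, h2⟩ | ⟨h1, h2⟩
    · rw [h2]
      exact ⟨rfl, rfl⟩
    · exact absurd h1 hs
  | fork v u y y' e a b hj ha hb hea heb hu hy hy' hsf =>
    exfalso
    rcases hx with rfl | rfl | rfl
    · rcases hj with ⟨h1, h2⟩ | ⟨h1, h2⟩
      · rw [h2] at hl
        exact c.not_isLeaf_iff.2 hu hl
      · exact hs (by simp [h1])
    · rcases ha with ⟨h1, h2⟩ | ⟨h1, h2⟩ <;> exact hs (by simp [h1])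
    · rcases hb with ⟨h1, h2⟩ | ⟨h1, h2⟩ <;> exact hs (by simp [h1])
  | cycle v u u' e a b vs es hj ha hb hea heb hsc ho ht hae hbe =>
    exfalso
    rcases hx with (rfl | rfl | rfl) | hx
    · rcases hj with ⟨h1, h2⟩ | ⟨h1, h2⟩
      · rw [h2] at hl
        exact c.not_isLeaf_iff.2 (Joins.isInner ha hsc.eq_pair.2.2.1).1 hl
      · exact hs (by simp [h1])
    · rcases ha with ⟨h1, h2⟩ | ⟨h1, h2⟩ <;> exact hs (by simp [h1])
    · rcases hb with ⟨h1, h2⟩ | ⟨h1, h2⟩ <;> exact hs (by simp [h1])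
    · refine hs ?_
      have := (ht.endpoint_mem x hx).1
      simp only [Set.mem_insert_iff, Set.mem_union, Set.mem_singleton_iff] at this ⊢
      tauto

/-- An edge outside the core lies in a tail, and an odd edge of a tail has both endpoints among the
tail's own vertices, which are disjoint from the core. -/
theorem IsZigzagCore.mem_of_odd {VS : Set c.V} {ES : Set c.E} (h : c.IsZigzagCore VS ES)
    {x : c.E} (hx : Odd (c.ω x)) (hs : c.src x ∈ VS ∨ c.tgt x ∈ VS) : x ∈ ES := by
  by_contra hn
  obtain ⟨v, hv, vs, es, ht, h1, h2, h3⟩ := h.tails.2 x hn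
  obtain ⟨h4, h5⟩ := ht.endpoint_mem_of_odd x h3 hx
  rcases hs with hs | hs
  · exact Set.disjoint_left.1 h1 h4 hs
  · exact Set.disjoint_left.1 h1 h5 hs

/-! ### The characteristic edge and its surroundings -/

variable (c)

/-- The edges around the characteristic edge `E` of a properly mixed cover: `i` enters `u`, and
`e`, `f` leave `u`; `e` and `j` enter the source of `E`, and `o` enters the target of `E`, from
which `h` leaves. -/
structure Mark (k₀ : Fin s) (l₀ : Fin t) where
  E : c.E
  i : c.E
  f : c.E
  e : c.E
  j : c.E
  o : c.E
  h : c.E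
  u : c.V
  sameKind : ∀ x, x ≠ E → SameKind z (c.φ (c.src x)) (c.φ (c.tgt x))
  φ_u : c.φ u = ((z.lo k₀ : ℝ) : EReal)
  φ_src_E : c.φ (c.src E) = ((z.hi k₀ : ℝ) : EReal)
  φ_tgt_E : c.φ (c.tgt E) = ((z.y l₀ : ℝ) : EReal)
  tgt_eq_u : ∀ x, c.tgt x = u ↔ x = i
  src_eq_u : ∀ x, c.src x = u ↔ x = f ∨ x = e
  f_ne_e : f ≠ e
  tgt_eq_src_E : ∀ x, c.tgt x = c.src E ↔ x = j ∨ x = e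
  j_ne_e : j ≠ e
  src_eq_src_E : ∀ x, c.src x = c.src E ↔ x = E
  tgt_eq_tgt_E : ∀ x, c.tgt x = c.tgt E ↔ x = E ∨ x = o
  E_ne_o : E ≠ o
  src_eq_tgt_E : ∀ x, c.src x = c.tgt E ↔ x = h
  φ_src_i : c.φ (c.src i) = ⊥
  φ_src_j : c.φ (c.src j) = ⊥
  φ_tgt_h : c.φ (c.tgt h) = ⊤
  φ_src_o : c.φ (c.src o) = ⊥ ∨ ∃ l, c.φ (c.src o) = ((z.y l : ℝ) : EReal)
  odd_E : Odd (c.ω E)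
  odd_i : Odd (c.ω i)
  odd_o : Odd (c.ω o)
  ω_i_eq_j : c.ω i = c.ω j
  ω_i : c.ω i = c.ω f + c.ω e
  ω_E : c.ω E = c.ω j + c.ω e
  ω_h : c.ω h = c.ω E + c.ω o

variable {c}

/-- The vertices reachable from one of the endpoints of `E` without using `E` are closed under
crossing any edge, `E` included; connectedness then gives all vertices. -/
theorem reach_or_reach (E : c.E) (v : c.V) : c.Reach {e | e ≠ E} (c.src E) v ∨
    c.Reach {e | e ≠ E} (c.tgt E) v := by
  have key : ∀ a b, Relation.EqvGen (fun a b => ∃ e, c.src e = a ∧ c.tgt e = b) a b →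
      ((c.Reach {e | e ≠ E} (c.src E) a ∨ c.Reach {e | e ≠ E} (c.tgt E) a) ↔
        (c.Reach {e | e ≠ E} (c.src E) b ∨ c.Reach {e | e ≠ E} (c.tgt E) b)) := by
    intro a b h
    induction h with
    | rel a b h =>
      obtain ⟨e, rfl, rfl⟩ := h
      by_cases he : e = E
      · subst he
        exact ⟨fun _ => Or.inr (.refl _), fun _ => Or.inl (.refl _)⟩
      · have h1 : c.Reach {e | e ≠ E} (c.src e) (c.tgt e) := .rel _ _ ⟨e, he, rfl, rfl⟩
        exact ⟨Or.imp (fun h => .trans _ _ _ h h1) (fun h => .trans _ _ _ h h1),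
          Or.imp (fun h => .trans _ _ _ h (.symm _ _ h1)) (fun h => .trans _ _ _ h (.symm _ _ h1))⟩
    | refl a => rfl
    | symm a b _ ih => exact ih.symm
    | trans a b c _ _ h1 h2 => exact h1.trans h2
  exact (key _ _ (c.connected (c.src E) v)).1 (Or.inl (.refl _))

end TropicalCover

open TropicalCover in
/-- A properly mixed cover has a characteristic edge with the surroundings described by `Mark`. -/
theorem IsProperlyMixed.exists_mark {d s t g : ℕ} {lam mu : Nat.Partition d}
    {w : Fin (2 * s + t) → ℝ} {hw : StrictMono w}
    {c : TropicalCover g lam mu (trivialDistribution s t w hw)} (hc : IsProperlyMixed c) :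
    ∃ (k₀ : Fin s) (l₀ : Fin t) (M : c.Mark k₀ l₀), k₀.1 = 0 ∧ l₀.1 + 1 = t ∧
      ∃ VS ES, c.IsZigzagCore VS ES ∧ M.E ∈ ES := by
  obtain ⟨hres, VS, ES, hcore, E, hE, hodd, hend, -, hpair, hsing, ⟨u, i, f, e, j,
    ⟨k₀, hk₀, hu, hsrc⟩, ⟨⟨hi, hf, he, he', hj, hfe, hje, hfj⟩, oi, of, ee, oj⟩, iend, jend, hij⟩,
    ⟨k, hk, htgt⟩, o, hoE, ho, oo⟩ := hc
  let z := trivialDistribution s t w hw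
  have hinner := (c.not_isEnd_iff E).1 hend
  obtain ⟨r, ⟨l₀, hl₀⟩, hr⟩ := hsing _ hinner.2 (.refl _)
  have htgt' : c.φ (c.tgt E) = ((z.y l₀ : ℝ) : EReal) := by rw [hr, hl₀]
  have hl : l₀.1 + 1 = t := by
    rw [htgt', EReal.coe_eq_coe_iff] at htgt
    have h1 := hw.injective htgt
    have h2 := congrArg Fin.val h1
    simp only at h2
    omega
  -- The target of `E` lies over the last of the `w`, so it is the highest branch point.
  have hmax : ∀ m, z.point m ≤ z.y l₀ := by
    rintro ((m | m) | m) <;>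
      exact hw.monotone (by rw [Fin.le_def]; simp only; omega)
  obtain ⟨i', hu1, hu2, hu3⟩ := c.eq_of_two_outgoing (c.isInner_of_eq hu) hfe hf he
  obtain rfl := (hu2 i).1 hi
  obtain ⟨E', hv1, hv2, hv3⟩ := c.eq_of_two_incoming hinner.1 hje hj he'
  obtain rfl := (hv2 E).1 rfl
  obtain ⟨h, hw1, hw2, hw3⟩ := c.eq_of_two_incoming hinner.2 hoE.symm rfl ho
  have hleaf : ∀ x, c.IsEnd x → (∃ r : ℝ, c.φ (c.tgt x) = r) → c.φ (c.src x) = ⊥ := by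
    rintro x hx ⟨r, hr⟩
    rw [← c.isLeaf_src_iff]
    refine hx.resolve_right ?_
    rw [c.isLeaf_tgt_iff, hr]
    simp
  -- An inner edge other than `E` stays on one side of `E`, and each side lies over points of one
  -- kind.
  have hkind : ∀ x, x ≠ E → SameKind z (c.φ (c.src x)) (c.φ (c.tgt x)) := by
    intro x hx
    by_cases h1 : c.IsLeaf (c.src x)
    · exact Or.inl ((c.isLeaf_src_iff x).1 h1)
    by_cases h2 : c.IsLeaf (c.tgt x)
    · exact Or.inr (Or.inl ((c.isLeaf_tgt_iff x).1 h2))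
    rw [c.not_isLeaf_iff] at h1 h2
    have h3 : c.Reach {e | e ≠ E} (c.src x) (c.tgt x) := .rel _ _ ⟨x, hx, rfl, rfl⟩
    rcases reach_or_reach E (c.src x) with h4 | h4
    · exact Or.inr (Or.inr (Or.inl ⟨hpair _ h1 h4, hpair _ h2 (.trans _ _ _ h4 h3)⟩))
    · exact Or.inr (Or.inr (Or.inr ⟨hsing _ h1 h4, hsing _ h2 (.trans _ _ _ h4 h3)⟩))
  refine ⟨k₀, l₀,
    { E := E, i := i, f := f, e := e, j := j, o := o, h := h, u := u
      sameKind := hkind, φ_u := hu, φ_src_E := hsrc, φ_tgt_E := htgt', tgt_eq_u := hu2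
      src_eq_u := hu1, f_ne_e := hfe, tgt_eq_src_E := hv1, j_ne_e := hje, src_eq_src_E := hv2
      tgt_eq_tgt_E := hw1, E_ne_o := hoE.symm, src_eq_tgt_E := hw2
      φ_src_i := hleaf i iend ⟨_, by rw [hi, hu]⟩, φ_src_j := hleaf j jend ⟨_, by rw [hj, hsrc]⟩
      φ_tgt_h := ?_, φ_src_o := ?_, odd_E := hodd, odd_i := oi, odd_o := oo, ω_i_eq_j := hij
      ω_i := hu3, ω_E := hv3, ω_h := hw3 }, hk₀, hl, VS, ES, hcore, hE⟩
  -- No inner vertex lies above the highest branch point, so `h` must run to `+∞`.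
  · rw [← c.isLeaf_tgt_iff]
    by_contra hn
    obtain ⟨m, hm⟩ := c.exists_point_of_isInner (c.not_isLeaf_iff.1 hn)
    have h1 := c.φ_lt h
    rw [hm, (hw2 h).2 rfl, htgt', EReal.coe_lt_coe_iff] at h1
    exact absurd (hmax m) (not_le.2 h1)
  · by_cases h1 : c.IsLeaf (c.src o)
    · exact Or.inl ((c.isLeaf_src_iff o).1 h1)
    · right
      have h2 : c.Reach {e | e ≠ E} (c.tgt E) (c.src o) := .symm _ _ (.rel _ _ ⟨o, hoE, rfl, ho⟩)
      obtain ⟨r, ⟨l, rfl⟩, hr⟩ := hsing _ (c.not_isLeaf_iff.1 h1) h2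
      exact ⟨l, hr⟩

/-! ### The rewiring at the characteristic edge -/

namespace TropicalCover

variable {d s t g : ℕ} {lam mu : Nat.Partition d} {z z' : Distribution s t}
variable {c : TropicalCover g lam mu z}

namespace Mark

variable {k₀ : Fin s} {l₀ : Fin t} (M : c.Mark k₀ l₀)

theorem tgt_i : c.tgt M.i = M.u := (M.tgt_eq_u _).2 rfl
theorem src_f : c.src M.f = M.u := (M.src_eq_u _).2 (Or.inl rfl)
theorem src_e : c.src M.e = M.u := (M.src_eq_u _).2 (Or.inr rfl)
theorem tgt_j : c.tgt M.j = c.src M.E := (M.tgt_eq_src_E _).2 (Or.inl rfl)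
theorem tgt_e : c.tgt M.e = c.src M.E := (M.tgt_eq_src_E _).2 (Or.inr rfl)
theorem tgt_o : c.tgt M.o = c.tgt M.E := (M.tgt_eq_tgt_E _).2 (Or.inr rfl)
theorem src_h : c.src M.h = c.tgt M.E := (M.src_eq_tgt_E _).2 rfl

theorem u_ne_src_E : M.u ≠ c.src M.E := fun h => by
  have := congrArg c.φ h
  rw [M.φ_u, M.φ_src_E, EReal.coe_eq_coe_iff] at this
  exact z.lo_ne_hi _ _ this

theorem u_ne_tgt_E : M.u ≠ c.tgt M.E := fun h => by
  have := congrArg c.φ h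
  rw [M.φ_u, M.φ_tgt_E, EReal.coe_eq_coe_iff] at this
  exact z.y_ne_lo _ _ this.symm

theorem src_E_ne_tgt_E : c.src M.E ≠ c.tgt M.E := c.src_ne_tgt _

theorem ne_of_tgt {x y : c.E} (h : c.tgt x ≠ c.tgt y) : x ≠ y := fun h' => h (h' ▸ rfl)

theorem i_ne_j : M.i ≠ M.j := ne_of_tgt (by rw [M.tgt_i, M.tgt_j]; exact M.u_ne_src_E)
theorem i_ne_E : M.i ≠ M.E := ne_of_tgt (by rw [M.tgt_i]; exact M.u_ne_tgt_E)
theorem i_ne_o : M.i ≠ M.o := ne_of_tgt (by rw [M.tgt_i, M.tgt_o]; exact M.u_ne_tgt_E)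
theorem i_ne_e : M.i ≠ M.e := ne_of_tgt (by rw [M.tgt_i, M.tgt_e]; exact M.u_ne_src_E)
theorem j_ne_E : M.j ≠ M.E := ne_of_tgt (by rw [M.tgt_j]; exact M.src_E_ne_tgt_E)
theorem j_ne_o : M.j ≠ M.o := ne_of_tgt (by rw [M.tgt_j, M.tgt_o]; exact M.src_E_ne_tgt_E)
theorem e_ne_E : M.e ≠ M.E := ne_of_tgt (by rw [M.tgt_e]; exact M.src_E_ne_tgt_E)
theorem e_ne_o : M.e ≠ M.o := ne_of_tgt (by rw [M.tgt_e, M.tgt_o]; exact M.src_E_ne_tgt_E)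

theorem h_ne_of_tgt {x : c.E} {r : ℝ} (hx : c.φ (c.tgt x) = (r : EReal)) : M.h ≠ x := by
  rintro h
  have := M.φ_tgt_h
  rw [h, hx] at this
  simp at this

theorem h_ne_i : M.h ≠ M.i := M.h_ne_of_tgt (by rw [M.tgt_i, M.φ_u])
theorem h_ne_j : M.h ≠ M.j := M.h_ne_of_tgt (by rw [M.tgt_j, M.φ_src_E])
theorem h_ne_e : M.h ≠ M.e := M.h_ne_of_tgt (by rw [M.tgt_e, M.φ_src_E])
theorem h_ne_E : M.h ≠ M.E := M.h_ne_of_tgt M.φ_tgt_E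
theorem h_ne_o : M.h ≠ M.o := M.h_ne_of_tgt (by rw [M.tgt_o, M.φ_tgt_E])

theorem f_ne_E : M.f ≠ M.E := fun h => M.u_ne_src_E (by rw [← M.src_f, h])

theorem f_ne_h : M.f ≠ M.h := fun h => M.u_ne_tgt_E (by rw [← M.src_f, h, M.src_h])

theorem src_o_ne_u : c.src M.o ≠ M.u := by
  intro h
  have h1 := M.φ_src_o
  rw [h, M.φ_u] at h1
  rcases h1 with h1 | ⟨l, h1⟩
  · simp at h1
  · rw [EReal.coe_eq_coe_iff] at h1
    exact z.y_ne_lo _ _ h1.symm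

theorem f_ne_o : M.f ≠ M.o := fun h => M.src_o_ne_u (by rw [← h, M.src_f])

open Classical in
/-- The permutation of the starting points. -/
noncomputable def σ : Equiv.Perm c.E := Equiv.swap M.E M.h

open Classical in
/-- The permutation of the end points. -/
noncomputable def τ : Equiv.Perm c.E := Equiv.swap M.i M.E * Equiv.swap M.j M.o

open Classical in
/-- The new weights. -/
noncomputable def weight (x : c.E) : ℕ :=
  if x = M.E then 2 * c.ω M.i else if x = M.e then c.ω M.E else c.ω x

theorem σ_E : M.σ M.E = M.h := by simp [σ]
theorem σ_h : M.σ M.h = M.E := by simp [σ]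
open Classical in
theorem σ_of_ne {x : c.E} (h1 : x ≠ M.E) (h2 : x ≠ M.h) : M.σ x = x :=
  Equiv.swap_apply_of_ne_of_ne h1 h2

open Classical in
theorem τ_i : M.τ M.i = M.E := by
  simp [τ, Equiv.swap_apply_of_ne_of_ne M.i_ne_j M.i_ne_o]
open Classical in
theorem τ_E : M.τ M.E = M.i := by
  simp [τ, Equiv.swap_apply_of_ne_of_ne M.j_ne_E.symm M.E_ne_o]
open Classical in
theorem τ_j : M.τ M.j = M.o := by
  simp [τ, Equiv.swap_apply_of_ne_of_ne M.i_ne_o.symm M.E_ne_o.symm]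
open Classical in
theorem τ_o : M.τ M.o = M.j := by
  simp [τ, Equiv.swap_apply_of_ne_of_ne M.i_ne_j.symm M.j_ne_E]
open Classical in
theorem τ_of_ne {x : c.E} (h1 : x ≠ M.i) (h2 : x ≠ M.E) (h3 : x ≠ M.j) (h4 : x ≠ M.o) :
    M.τ x = x := by
  simp [τ, Equiv.swap_apply_of_ne_of_ne h1 h2, Equiv.swap_apply_of_ne_of_ne h3 h4]

theorem τ_e : M.τ M.e = M.e :=
  M.τ_of_ne M.i_ne_e.symm M.e_ne_E M.j_ne_e.symm M.e_ne_o
theorem τ_h : M.τ M.h = M.h := M.τ_of_ne M.h_ne_i M.h_ne_E M.h_ne_j M.h_ne_o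
theorem σ_e : M.σ M.e = M.e := M.σ_of_ne M.e_ne_E M.h_ne_e.symm
theorem σ_f : M.σ M.f = M.f := M.σ_of_ne M.f_ne_E M.f_ne_h
theorem σ_i : M.σ M.i = M.i := M.σ_of_ne M.i_ne_E M.h_ne_i.symm
theorem σ_j : M.σ M.j = M.j := M.σ_of_ne M.j_ne_E M.h_ne_j.symm
theorem σ_o : M.σ M.o = M.o := M.σ_of_ne M.E_ne_o.symm M.h_ne_o.symm

theorem weight_E : M.weight M.E = 2 * c.ω M.i := by simp [weight]
theorem weight_e : M.weight M.e = c.ω M.E := by simp [weight, M.e_ne_E]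
theorem weight_of_ne {x : c.E} (h1 : x ≠ M.E) (h2 : x ≠ M.e) : M.weight x = c.ω x := by
  simp [weight, h1, h2]

/-- The edges that keep their endpoints and their weight. -/
def Old (x : c.E) : Prop :=
  x ≠ M.E ∧ x ≠ M.h ∧ x ≠ M.i ∧ x ≠ M.j ∧ x ≠ M.o ∧ x ≠ M.e

variable {M}

theorem Old.σ {x : c.E} (h : M.Old x) : M.σ x = x := M.σ_of_ne h.1 h.2.1
theorem Old.τ {x : c.E} (h : M.Old x) : M.τ x = x := M.τ_of_ne h.2.2.1 h.1 h.2.2.2.1 h.2.2.2.2.1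
theorem Old.weight {x : c.E} (h : M.Old x) : M.weight x = c.ω x := M.weight_of_ne h.1 h.2.2.2.2.2

variable (M)

theorem cases_edge (x : c.E) :
    x = M.E ∨ x = M.h ∨ x = M.i ∨ x = M.j ∨ x = M.o ∨ x = M.e ∨ M.Old x := by
  unfold Old
  tauto

theorem src_σ_eq_u (x : c.E) : c.src (M.σ x) = M.u ↔ x = M.f ∨ x = M.e := by
  rw [M.src_eq_u, ← M.σ.apply_eq_iff_eq (x := x) (y := M.f),
    ← M.σ.apply_eq_iff_eq (x := x) (y := M.e), M.σ_f, M.σ_e]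

theorem src_σ_eq_src_E (x : c.E) : c.src (M.σ x) = c.src M.E ↔ x = M.h := by
  rw [M.src_eq_src_E, ← M.σ.apply_eq_iff_eq (x := x) (y := M.h), M.σ_h]

theorem src_σ_eq_tgt_E (x : c.E) : c.src (M.σ x) = c.tgt M.E ↔ x = M.E := by
  rw [M.src_eq_tgt_E, ← M.σ.apply_eq_iff_eq (x := x) (y := M.E), M.σ_E]

theorem tgt_τ_eq_u (x : c.E) : c.tgt (M.τ x) = M.u ↔ x = M.E := by
  rw [M.tgt_eq_u, ← M.τ.apply_eq_iff_eq (x := x) (y := M.E), M.τ_E]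

theorem tgt_τ_eq_src_E (x : c.E) : c.tgt (M.τ x) = c.src M.E ↔ x = M.o ∨ x = M.e := by
  rw [M.tgt_eq_src_E, ← M.τ.apply_eq_iff_eq (x := x) (y := M.o),
    ← M.τ.apply_eq_iff_eq (x := x) (y := M.e), M.τ_o, M.τ_e]

theorem tgt_τ_eq_tgt_E (x : c.E) : c.tgt (M.τ x) = c.tgt M.E ↔ x = M.i ∨ x = M.j := by
  rw [M.tgt_eq_tgt_E, ← M.τ.apply_eq_iff_eq (x := x) (y := M.i),
    ← M.τ.apply_eq_iff_eq (x := x) (y := M.j), M.τ_i, M.τ_j]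

/-- The new `E` rises from the single point to the pair, which is exactly `hlt`. The edge `o` now
ends over the pair, above its former end point; the ends pose no problem, and the remaining edges
join points of the same kind. -/
theorem φ_lt_rewired (hlt : z'.y l₀ < z'.lo k₀) (x : c.E) :
    movePoints z z' (c.φ (c.src (M.σ x))) < movePoints z z' (c.φ (c.tgt (M.τ x))) := by
  have hlt' := hlt.trans (z'.lo_lt_hi k₀)
  rcases M.cases_edge x with rfl | rfl | rfl | rfl | rfl | rfl | h
  · rw [M.σ_E, M.τ_E, M.src_h, M.tgt_i, M.φ_u, M.φ_tgt_E, movePoints_lo, movePoints_y]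
    exact EReal.coe_lt_coe_iff.2 hlt
  · rw [M.σ_h, M.τ_h, M.φ_src_E, M.φ_tgt_h, movePoints_hi, movePoints_top]
    exact EReal.coe_lt_top _
  · rw [M.σ_i, M.τ_i, M.φ_src_i, M.φ_tgt_E, movePoints_bot, movePoints_y]
    exact EReal.bot_lt_coe _
  · rw [M.σ_j, M.τ_j, M.φ_src_j, M.tgt_o, M.φ_tgt_E, movePoints_bot, movePoints_y]
    exact EReal.bot_lt_coe _
  · rw [M.σ_o, M.τ_o, M.tgt_j, M.φ_src_E, movePoints_hi]
    have hsk := M.sameKind M.o M.E_ne_o.symm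
    have h1 := movePoints_lt z z' (c.φ_mem_vertexValues _) (c.φ_mem_vertexValues _)
      (c.φ_lt M.o) hsk
    rw [M.tgt_o, M.φ_tgt_E, movePoints_y] at h1
    exact h1.trans (EReal.coe_lt_coe_iff.2 hlt')
  · rw [M.σ_e, M.τ_e]
    exact movePoints_lt z z' (c.φ_mem_vertexValues _) (c.φ_mem_vertexValues _) (c.φ_lt _)
      (M.sameKind _ M.e_ne_E)
  · rw [h.σ, h.τ]
    exact movePoints_lt z z' (c.φ_mem_vertexValues _) (c.φ_mem_vertexValues _) (c.φ_lt _)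
      (M.sameKind _ h.1)

/-- The new edges `E` and `e` form a path through the three central vertices. Every old edge is kept
or can be replaced by a rewired edge together with pieces of this path. -/
theorem connected_rewired (a b : c.V) :
    Relation.EqvGen (fun a b => ∃ x, c.src (M.σ x) = a ∧ c.tgt (M.τ x) = b) a b := by
  have hE : Relation.EqvGen (fun a b => ∃ x, c.src (M.σ x) = a ∧ c.tgt (M.τ x) = b)
      (c.tgt M.E) M.u := .rel _ _ ⟨M.E, (M.src_σ_eq_tgt_E _).2 rfl, (M.tgt_τ_eq_u _).2 rfl⟩
  have he : Relation.EqvGen (fun a b => ∃ x, c.src (M.σ x) = a ∧ c.tgt (M.τ x) = b)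
      M.u (c.src M.E) := .rel _ _ ⟨M.e, (M.src_σ_eq_u _).2 (Or.inr rfl),
        (M.tgt_τ_eq_src_E _).2 (Or.inr rfl)⟩
  refine eqvGen_map id ?_ (c.connected a b)
  rintro a b ⟨x, rfl, rfl⟩
  simp only [id]
  rcases M.cases_edge x with rfl | rfl | rfl | rfl | rfl | rfl | h
  · exact .symm _ _ (.trans _ _ _ hE he)
  · rw [M.src_h]
    refine .trans _ _ _ (.trans _ _ _ hE he) (.rel _ _ ⟨M.h, (M.src_σ_eq_src_E _).2 rfl, ?_⟩)
    rw [M.τ_h]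
  · rw [M.tgt_i]
    exact .trans _ _ _ (.rel _ _ ⟨M.i, by rw [M.σ_i], (M.tgt_τ_eq_tgt_E _).2 (Or.inl rfl)⟩) hE
  · rw [M.tgt_j]
    exact .trans _ _ _ (.rel _ _ ⟨M.j, by rw [M.σ_j], (M.tgt_τ_eq_tgt_E _).2 (Or.inr rfl)⟩)
      (.trans _ _ _ hE he)
  · rw [M.tgt_o]
    exact .trans _ _ _ (.rel _ _ ⟨M.o, by rw [M.σ_o], (M.tgt_τ_eq_src_E _).2 (Or.inl rfl)⟩)
      (.symm _ _ (.trans _ _ _ hE he))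
  · rw [M.src_e, M.tgt_e]
    exact he
  · exact .rel _ _ ⟨x, by rw [h.σ], by rw [h.τ]⟩

/-- Away from the three central vertices, `h` is the only changed edge that can end there, and its
target and weight are unchanged. Together with `old_of_src` this confines the checks of balancing to
the central vertices and leaves the weights of the ends alone. -/
theorem old_of_tgt {x : c.E} {v : c.V} (h1 : v ≠ M.u) (h2 : v ≠ c.src M.E) (h3 : v ≠ c.tgt M.E)
    (hx : c.tgt x = v ∨ c.tgt (M.τ x) = v) : x = M.h ∨ M.Old x := by
  rcases M.cases_edge x with rfl | rfl | rfl | rfl | rfl | rfl | h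
  · rw [M.τ_E, M.tgt_i] at hx
    rcases hx with rfl | rfl <;> contradiction
  · exact Or.inl rfl
  · rw [M.τ_i, M.tgt_i] at hx
    rcases hx with rfl | rfl <;> contradiction
  · rw [M.τ_j, M.tgt_j, M.tgt_o] at hx
    rcases hx with rfl | rfl <;> contradiction
  · rw [M.τ_o, M.tgt_j, M.tgt_o] at hx
    rcases hx with rfl | rfl <;> contradiction
  · rw [M.τ_e, M.tgt_e] at hx
    rcases hx with rfl | rfl <;> contradiction
  · exact Or.inr h

theorem old_of_src {x : c.E} {v : c.V} (h1 : v ≠ M.u) (h2 : v ≠ c.src M.E) (h3 : v ≠ c.tgt M.E)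
    (hx : c.src x = v ∨ c.src (M.σ x) = v) : x = M.i ∨ x = M.j ∨ x = M.o ∨ M.Old x := by
  rcases M.cases_edge x with rfl | rfl | rfl | rfl | rfl | rfl | h
  · rw [M.σ_E, M.src_h] at hx
    rcases hx with rfl | rfl <;> contradiction
  · rw [M.σ_h, M.src_h] at hx
    rcases hx with rfl | rfl <;> contradiction
  · tauto
  · tauto
  · tauto
  · rw [M.σ_e, M.src_e] at hx
    rcases hx with rfl | rfl <;> contradiction
  · tauto

theorem tgt_and_weight {x : c.E} {v : c.V} (h1 : v ≠ M.u) (h2 : v ≠ c.src M.E)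
    (h3 : v ≠ c.tgt M.E) (hx : c.tgt x = v ∨ c.tgt (M.τ x) = v) :
    M.τ x = x ∧ M.weight x = c.ω x := by
  rcases M.old_of_tgt h1 h2 h3 hx with rfl | h
  · exact ⟨M.τ_h, M.weight_of_ne M.h_ne_E M.h_ne_e⟩
  · exact ⟨h.τ, h.weight⟩

theorem src_and_weight {x : c.E} {v : c.V} (h1 : v ≠ M.u) (h2 : v ≠ c.src M.E)
    (h3 : v ≠ c.tgt M.E) (hx : c.src x = v ∨ c.src (M.σ x) = v) :
    M.σ x = x ∧ M.weight x = c.ω x := by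
  rcases M.old_of_src h1 h2 h3 hx with rfl | rfl | rfl | h
  · exact ⟨M.σ_i, M.weight_of_ne M.i_ne_E M.i_ne_e⟩
  · exact ⟨M.σ_j, M.weight_of_ne M.j_ne_E M.j_ne_e⟩
  · exact ⟨M.σ_o, M.weight_of_ne M.E_ne_o.symm M.e_ne_o.symm⟩
  · exact ⟨h.σ, h.weight⟩

-- At the former target of `E`, `i` and `j` add up to `2 ω(i)`. At `u`, what remains after `f` is `2
-- ω(i) - ω(f) = ω(j) + ω(e)`, the old weight of `E`. At the former source of `E`, this and `ω(o)`
-- add up to `ω(h)`.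
open Classical in
theorem balanced_rewired (v : c.V) (hv : c.IsInner v) :
    ∑ x with c.tgt (M.τ x) = v, M.weight x = ∑ x with c.src (M.σ x) = v, M.weight x := by
  have hset : ∀ (p : c.E → Prop) (a : c.E), (∀ x, p x ↔ x = a) →
      ∑ x with p x, M.weight x = M.weight a := by
    intro p a h
    have : (Finset.univ.filter p) = {a} := by ext x; simp [h]
    rw [this, Finset.sum_singleton]
  have hset2 : ∀ (p : c.E → Prop) (a b : c.E), a ≠ b → (∀ x, p x ↔ x = a ∨ x = b) →
      ∑ x with p x, M.weight x = M.weight a + M.weight b := by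
    intro p a b hab h
    have : (Finset.univ.filter p) = {a, b} := by ext x; simp [h]
    rw [this, Finset.sum_pair hab]
  have wi := M.weight_of_ne M.i_ne_E M.i_ne_e
  have wj := M.weight_of_ne M.j_ne_E M.j_ne_e
  have wo := M.weight_of_ne M.E_ne_o.symm M.e_ne_o.symm
  have wf := M.weight_of_ne M.f_ne_E M.f_ne_e
  have wh := M.weight_of_ne M.h_ne_E M.h_ne_e
  have := M.ω_i_eq_j
  have := M.ω_i
  have := M.ω_E
  have := M.ω_h
  by_cases h1 : v = M.u
  · subst h1
    rw [hset _ _ M.tgt_τ_eq_u, hset2 _ _ _ M.f_ne_e M.src_σ_eq_u, M.weight_E, M.weight_e, wf]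
    omega
  by_cases h2 : v = c.src M.E
  · subst h2
    rw [hset2 _ _ _ M.e_ne_o.symm M.tgt_τ_eq_src_E, hset _ _ M.src_σ_eq_src_E, M.weight_e, wo, wh]
    omega
  by_cases h3 : v = c.tgt M.E
  · subst h3
    rw [hset2 _ _ _ M.i_ne_j M.tgt_τ_eq_tgt_E, hset _ _ M.src_σ_eq_tgt_E, M.weight_E, wi, wj]
    omega
  have e1 : ∑ x with c.tgt (M.τ x) = v, M.weight x = ∑ x with c.tgt x = v, c.ω x := by
    refine Finset.sum_congr ?_ fun x hx =>
      (M.tgt_and_weight h1 h2 h3 (Or.inl (Finset.mem_filter.1 hx).2)).2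
    ext x
    simp only [Finset.mem_filter, Finset.mem_univ, true_and]
    refine ⟨fun h => ?_, fun h => ?_⟩
    · rwa [(M.tgt_and_weight h1 h2 h3 (Or.inr h)).1] at h
    · rwa [(M.tgt_and_weight h1 h2 h3 (Or.inl h)).1]
  have e2 : ∑ x with c.src (M.σ x) = v, M.weight x = ∑ x with c.src x = v, c.ω x := by
    refine Finset.sum_congr ?_ fun x hx =>
      (M.src_and_weight h1 h2 h3 (Or.inl (Finset.mem_filter.1 hx).2)).2
    ext x
    simp only [Finset.mem_filter, Finset.mem_univ, true_and]
    refine ⟨fun h => ?_, fun h => ?_⟩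
    · rwa [(M.src_and_weight h1 h2 h3 (Or.inr h)).1] at h
    · rwa [(M.src_and_weight h1 h2 h3 (Or.inl h)).1]
  rw [e1, e2, c.balanced v hv]

theorem ne_of_isLeaf {v : c.V} (hv : c.IsLeaf v) :
    v ≠ M.u ∧ v ≠ c.src M.E ∧ v ≠ c.tgt M.E := by
  rw [c.isLeaf_iff] at hv
  refine ⟨?_, ?_, ?_⟩ <;> rintro rfl
  · simp [M.φ_u] at hv
  · simp [M.φ_src_E] at hv
  · simp [M.φ_tgt_E] at hv

open Classical in
theorem ends_lam_rewired :
    (Finset.univ.filter fun x => c.φ (c.src (M.σ x)) = ⊥).val.map M.weight = lam.parts := by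
  have key : ∀ x, c.φ (c.src x) = ⊥ ∨ c.φ (c.src (M.σ x)) = ⊥ →
      M.σ x = x ∧ M.weight x = c.ω x := by
    rintro x (hx | hx)
    · obtain ⟨h1, h2, h3⟩ := M.ne_of_isLeaf (c.isLeaf_iff.2 (Or.inl hx))
      exact M.src_and_weight h1 h2 h3 (Or.inl rfl)
    · obtain ⟨h1, h2, h3⟩ := M.ne_of_isLeaf (c.isLeaf_iff.2 (Or.inl hx))
      exact M.src_and_weight h1 h2 h3 (Or.inr rfl)
  have hf : (Finset.univ.filter fun x => c.φ (c.src (M.σ x)) = ⊥) =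
      Finset.univ.filter fun x => c.φ (c.src x) = ⊥ := by
    ext x
    simp only [Finset.mem_filter, Finset.mem_univ, true_and]
    refine ⟨fun h => ?_, fun h => ?_⟩
    · rwa [(key x (Or.inr h)).1] at h
    · rwa [(key x (Or.inl h)).1]
  rw [hf, ← c.ends_lam]
  refine Multiset.map_congr rfl fun x hx => (key x (Or.inl ?_)).2
  rw [Finset.mem_val] at hx
  exact (Finset.mem_filter.1 hx).2

open Classical in
theorem ends_mu_rewired :
    (Finset.univ.filter fun x => c.φ (c.tgt (M.τ x)) = ⊤).val.map M.weight = mu.parts := by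
  have key : ∀ x, c.φ (c.tgt x) = ⊤ ∨ c.φ (c.tgt (M.τ x)) = ⊤ →
      M.τ x = x ∧ M.weight x = c.ω x := by
    rintro x (hx | hx)
    · obtain ⟨h1, h2, h3⟩ := M.ne_of_isLeaf (c.isLeaf_iff.2 (Or.inr hx))
      exact M.tgt_and_weight h1 h2 h3 (Or.inl rfl)
    · obtain ⟨h1, h2, h3⟩ := M.ne_of_isLeaf (c.isLeaf_iff.2 (Or.inr hx))
      exact M.tgt_and_weight h1 h2 h3 (Or.inr rfl)
  have hf : (Finset.univ.filter fun x => c.φ (c.tgt (M.τ x)) = ⊤) =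
      Finset.univ.filter fun x => c.φ (c.tgt x) = ⊤ := by
    ext x
    simp only [Finset.mem_filter, Finset.mem_univ, true_and]
    refine ⟨fun h => ?_, fun h => ?_⟩
    · rwa [(key x (Or.inr h)).1] at h
    · rwa [(key x (Or.inl h)).1]
  rw [hf, ← c.ends_mu]
  refine Multiset.map_congr rfl fun x hx => (key x (Or.inl ?_)).2
  rw [Finset.mem_val] at hx
  exact (Finset.mem_filter.1 hx).2

/-- If the last single point moves above the first pair, then only the map has to be changed. -/
noncomputable def keep (hlt : z'.hi k₀ < z'.y l₀) : c.Rewiring z' where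
  σ := Equiv.refl _
  τ := Equiv.refl _
  ω := c.ω
  ω_pos := c.ω_pos
  φ_lt x := by
    by_cases hx : x = M.E
    · subst hx
      simp only [Equiv.refl_apply, M.φ_src_E, M.φ_tgt_E, movePoints_hi, movePoints_y]
      exact EReal.coe_lt_coe_iff.2 hlt
    · exact movePoints_lt z z' (c.φ_mem_vertexValues _) (c.φ_mem_vertexValues _) (c.φ_lt _)
        (M.sameKind _ hx)
  connected := c.connected
  balanced := c.balanced
  ends_lam := c.ends_lam
  ends_mu := c.ends_mu

theorem keep_fixes (hlt : z'.hi k₀ < z'.y l₀) (x : c.E) : (M.keep hlt).Fixes x :=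
  ⟨rfl, rfl, rfl⟩

/-- If the last single point moves below the first pair, then the surroundings of the
characteristic edge are rewired: the ends `i` and `j` form a symmetric fork at the former target
of `E`, the edge `E` leads from there to `u`, the edge `o` enters the former source of `E`, and
`h` leaves it. -/
noncomputable def cross (hlt : z'.y l₀ < z'.lo k₀) : c.Rewiring z' where
  σ := M.σ
  τ := M.τ
  ω := M.weight
  ω_pos x := by
    have h1 := c.ω_pos
    unfold weight
    split_ifs
    · have := h1 M.i
      omega
    · exact h1 _
    · exact h1 _
  φ_lt := M.φ_lt_rewired hlt
  connected := M.connected_rewired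
  balanced := M.balanced_rewired
  ends_lam := M.ends_lam_rewired
  ends_mu := M.ends_mu_rewired

end Mark

end TropicalCover

/-! ### The rewired cover is a generalized zigzag cover -/

namespace TropicalCover

variable {d s t g : ℕ} {lam mu : Nat.Partition d} {z z' : Distribution s t}
variable {c : TropicalCover g lam mu z}

theorem eq_of_src_isLeaf {v : c.V} (hv : c.IsLeaf v) {x y : c.E} (hx : c.src x = v)
    (hy : c.src y = v) : x = y := by
  unfold TropicalCurve.IsLeaf TropicalCurve.valence at hv
  exact (Set.ncard_le_one (Set.toFinite _)).1 (by omega : {e | c.src e = v}.ncard ≤ 1) x hx y hy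

theorem IsTail.exists_incident {v : c.V} {vs : Set c.V} {es : Set c.E} (h : c.IsTail v vs es) :
    ∃ x ∈ es, c.Incident x v := by
  cases h with
  | leaf v u e hj hu he => exact ⟨e, rfl, (Joins.incident hj).1⟩
  | fork v u x x' e a b hj => exact ⟨e, Or.inl rfl, (Joins.incident hj).1⟩
  | cycle v u u' e a b vs es hj => exact ⟨e, Or.inl (Or.inl rfl), (Joins.incident hj).1⟩

namespace Mark

variable {k₀ : Fin s} {l₀ : Fin t} (M : c.Mark k₀ l₀)

theorem isInner_u : c.IsInner M.u := c.isInner_of_eq M.φ_u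
theorem isInner_src_E : c.IsInner (c.src M.E) := c.isInner_of_eq M.φ_src_E
theorem isInner_tgt_E : c.IsInner (c.tgt M.E) := c.isInner_of_eq M.φ_tgt_E
theorem isLeaf_src_i : c.IsLeaf (c.src M.i) := (c.isLeaf_src_iff _).2 M.φ_src_i
theorem isLeaf_src_j : c.IsLeaf (c.src M.j) := (c.isLeaf_src_iff _).2 M.φ_src_j
theorem isLeaf_tgt_h : c.IsLeaf (c.tgt M.h) := (c.isLeaf_tgt_iff _).2 M.φ_tgt_h

theorem src_eq_src_i {x : c.E} (hx : c.src x = c.src M.i) : x = M.i :=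
  eq_of_src_isLeaf M.isLeaf_src_i hx rfl
theorem src_eq_src_j {x : c.E} (hx : c.src x = c.src M.j) : x = M.j :=
  eq_of_src_isLeaf M.isLeaf_src_j hx rfl

theorem tgt_ne_src_i (x : c.E) : c.tgt x ≠ c.src M.i := fun h => by
  have h1 := c.φ_lt x
  rw [h, M.φ_src_i] at h1
  exact not_lt_bot h1
theorem tgt_ne_src_j (x : c.E) : c.tgt x ≠ c.src M.j := fun h => by
  have h1 := c.φ_lt x
  rw [h, M.φ_src_j] at h1
  exact not_lt_bot h1

/-- The vertices that are moved to the new symmetric fork. -/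
def forkVerts : Set c.V := {c.tgt M.E, c.src M.i, c.src M.j}

/-- The edges that are moved to the new symmetric fork. -/
def forkEdges : Set c.E := {M.E, M.i, M.j}

theorem src_notMem_forkVerts {x : c.E} (h1 : x ≠ M.h) (h2 : x ≠ M.i) (h3 : x ≠ M.j) :
    c.src x ∉ M.forkVerts := by
  rintro (h | h | h)
  · exact h1 ((M.src_eq_tgt_E x).1 h)
  · exact h2 (M.src_eq_src_i h)
  · exact h3 (M.src_eq_src_j h)

theorem tgt_notMem_forkVerts {x : c.E} (h1 : x ≠ M.E) (h2 : x ≠ M.o) :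
    c.tgt x ∉ M.forkVerts := by
  rintro (h | h | h)
  · exact ((M.tgt_eq_tgt_E x).1 h).elim h1 h2
  · exact M.tgt_ne_src_i x h
  · exact M.tgt_ne_src_j x h

theorem u_notMem_forkVerts : M.u ∉ M.forkVerts := by
  rw [← M.tgt_i]
  exact M.tgt_notMem_forkVerts M.i_ne_E M.i_ne_o

theorem src_E_notMem_forkVerts : c.src M.E ∉ M.forkVerts := by
  rw [← M.tgt_j]
  exact M.tgt_notMem_forkVerts M.j_ne_E M.j_ne_o

theorem cross_fixes (hlt : z'.y l₀ < z'.lo k₀) {x : c.E} (hx : M.Old x) :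
    (M.cross hlt).Fixes x := by
  refine ⟨?_, ?_, hx.weight⟩
  · exact congrArg c.src hx.σ
  · exact congrArg c.tgt hx.τ

theorem eq_or_old_of_isContractible {x : c.E} (hx : c.IsContractible x) :
    x = M.e ∨ M.Old x := by
  obtain ⟨k, h1, h2⟩ := hx
  rcases M.cases_edge x with rfl | rfl | rfl | rfl | rfl | h
  · rw [M.φ_src_E, EReal.coe_eq_coe_iff] at h1
    exact absurd h1.symm (z.lo_ne_hi _ _)
  · simp [M.φ_tgt_h] at h2
  · simp [M.φ_src_i] at h1
  · simp [M.φ_src_j] at h1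
  · rw [M.tgt_o, M.φ_tgt_E, EReal.coe_eq_coe_iff] at h2
    exact absurd h2 (z.y_ne_hi _ _)
  · exact h

theorem isContractible_e : c.IsContractible M.e :=
  ⟨k₀, by rw [M.src_e, M.φ_u], by rw [M.tgt_e, M.φ_src_E]⟩

theorem σ_τ_of_isContractible {x : c.E} (hx : c.IsContractible x) : M.σ x = x ∧ M.τ x = x := by
  rcases M.eq_or_old_of_isContractible hx with rfl | h
  · exact ⟨M.σ_e, M.τ_e⟩
  · exact ⟨h.σ, h.τ⟩

/-- The edge `e` still joins the two vertices over the pair `k₀`. Each other changed edge, before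
and after, has an endpoint over `±∞` or over a single point and so is not contractible. -/
theorem cross_isContractible_iff (hlt : z'.y l₀ < z'.lo k₀) (x : c.E) :
    (M.cross hlt).cover.IsContractible x ↔ c.IsContractible x := by
  rw [(M.cross hlt).isContractible_iff]
  change (∃ k : Fin s, c.φ (c.src (M.σ x)) = (z.lo k : EReal) ∧
      c.φ (c.tgt (M.τ x)) = (z.hi k : EReal)) ↔ _
  refine ⟨?_, fun h => ?_⟩
  · rintro ⟨k, h1, h2⟩
    rcases M.cases_edge x with rfl | rfl | rfl | rfl | rfl | rfl | h
    · rw [M.σ_E, M.src_h, M.φ_tgt_E, EReal.coe_eq_coe_iff] at h1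
      exact absurd h1 (z.y_ne_lo _ _)
    · simp [M.τ_h, M.φ_tgt_h] at h2
    · simp [M.σ_i, M.φ_src_i] at h1
    · simp [M.σ_j, M.φ_src_j] at h1
    · rw [M.σ_o] at h1
      rcases M.φ_src_o with h | ⟨l, h⟩
      · simp [h] at h1
      · rw [h, EReal.coe_eq_coe_iff] at h1
        exact absurd h1 (z.y_ne_lo _ _)
    · exact M.isContractible_e
    · rw [h.σ] at h1
      rw [h.τ] at h2
      exact ⟨k, h1, h2⟩
  · rw [(M.σ_τ_of_isContractible h).1, (M.σ_τ_of_isContractible h).2]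
    exact h

/-- The changed edges have endpoints only among the three central vertices, leaves, and the source
of `o`, which lies over `-∞` or a single point. Hence none of them meets another pair. -/
theorem old_of_incident {k : Fin s} (hk : k ≠ k₀) {a : c.V}
    (ha : c.φ a = ((z.lo k : ℝ) : EReal) ∨ c.φ a = ((z.hi k : ℝ) : EReal)) {x : c.E}
    (hx : c.Incident x a) : M.Old x := by
  have hinner : ¬ c.IsLeaf a := by
    rw [c.isLeaf_iff]
    rcases ha with h | h <;> simp [h]
  have hu : a ≠ M.u := by
    rintro rfl
    rw [M.φ_u, EReal.coe_eq_coe_iff, EReal.coe_eq_coe_iff] at ha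
    rcases ha with h | h
    · exact hk (z.lo_strictMono.injective h).symm
    · exact z.lo_ne_hi _ _ h
  have hv : a ≠ c.src M.E := by
    rintro rfl
    rw [M.φ_src_E, EReal.coe_eq_coe_iff, EReal.coe_eq_coe_iff] at ha
    rcases ha with h | h
    · exact z.lo_ne_hi _ _ h.symm
    · exact hk (z.hi_strictMono.injective h).symm
  have hy : ∀ l, c.φ a ≠ ((z.y l : ℝ) : EReal) := by
    intro l h
    rw [h, EReal.coe_eq_coe_iff, EReal.coe_eq_coe_iff] at ha
    exact ha.elim (z.y_ne_lo _ _) (z.y_ne_hi _ _)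
  have hw : a ≠ c.tgt M.E := by
    rintro rfl
    exact hy _ M.φ_tgt_E
  rcases hx with hx | hx
  · rcases M.old_of_src hu hv hw (Or.inl hx) with rfl | rfl | rfl | h
    · exact absurd M.isLeaf_src_i (hx ▸ hinner)
    · exact absurd M.isLeaf_src_j (hx ▸ hinner)
    · rcases M.φ_src_o with h | ⟨l, h⟩
      · exact absurd ((c.isLeaf_src_iff _).2 h) (hx ▸ hinner)
      · exact absurd h (hx ▸ hy l)
    · exact h
  · rcases M.old_of_tgt hu hv hw (Or.inl hx) with rfl | h
    · exact absurd M.isLeaf_tgt_h (hx ▸ hinner)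
    · exact h

theorem cross_isResolving (hlt : z'.y l₀ < z'.lo k₀) (hc : c.IsResolving) :
    (M.cross hlt).cover.IsResolving := by
  intro k
  by_cases hk : k = k₀
  · subst hk
    refine ⟨M.u, c.src M.E, ((M.cross hlt).isInner_iff _).2 M.isInner_u,
      ((M.cross hlt).isInner_iff _).2 M.isInner_src_E, c.movePoints_eq_lo.2 M.φ_u,
      -- The crossing picture survives over the pair `k₀`, with `E` in the role of `i` and `o` in
      -- the role of `j`. The contractible edge `e` has become odd, which this picture allows.
      c.movePoints_eq_hi.2 M.φ_src_E, Or.inr (Or.inr (Or.inl ⟨M.E, M.f, M.e, M.o, ?_⟩))⟩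
    exact ⟨(M.tgt_τ_eq_u _).2 rfl, (M.src_σ_eq_u _).2 (Or.inl rfl),
      (M.src_σ_eq_u _).2 (Or.inr rfl), (M.tgt_τ_eq_src_E _).2 (Or.inr rfl),
      (M.tgt_τ_eq_src_E _).2 (Or.inl rfl), M.f_ne_e, M.e_ne_o.symm, M.f_ne_o⟩
  · obtain ⟨v, v', hv, hv', h1, h2, h3⟩ := hc k
    refine ⟨v, v', ((M.cross hlt).isInner_iff _).2 hv, ((M.cross hlt).isInner_iff _).2 hv',
      c.movePoints_eq_lo.2 h1, c.movePoints_eq_hi.2 h2, pictures_rewire ?_ h3⟩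
    rintro x (hx | hx)
    · exact M.cross_fixes hlt (M.old_of_incident hk (Or.inl h1) hx)
    · exact M.cross_fixes hlt (M.old_of_incident hk (Or.inr h2) hx)

theorem cross_isEnd_iff (hlt : z'.y l₀ < z'.lo k₀) (x : c.E) :
    (M.cross hlt).curve.IsEnd x ↔ c.IsLeaf (c.src (M.σ x)) ∨ c.IsLeaf (c.tgt (M.τ x)) :=
  (M.cross hlt).isEnd_iff x

theorem cross_not_isEnd_E (hlt : z'.y l₀ < z'.lo k₀) : ¬ (M.cross hlt).curve.IsEnd M.E := by
  rw [M.cross_isEnd_iff, (M.src_σ_eq_tgt_E _).2 rfl, (M.tgt_τ_eq_u _).2 rfl, not_or,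
    c.not_isLeaf_iff, c.not_isLeaf_iff]
  exact ⟨M.isInner_tgt_E, M.isInner_u⟩

theorem cross_isEnd_i (hlt : z'.y l₀ < z'.lo k₀) : (M.cross hlt).curve.IsEnd M.i := by
  rw [M.cross_isEnd_iff, M.σ_i]
  exact Or.inl M.isLeaf_src_i

theorem cross_isEnd_j (hlt : z'.y l₀ < z'.lo k₀) : (M.cross hlt).curve.IsEnd M.j := by
  rw [M.cross_isEnd_iff, M.σ_j]
  exact Or.inl M.isLeaf_src_j

theorem incident_tgt_E_iff (x : c.E) (hlt : z'.y l₀ < z'.lo k₀) :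
    (M.cross hlt).curve.Incident x (c.tgt M.E) ↔ x = M.E ∨ x = M.i ∨ x = M.j :=
  or_congr (M.src_σ_eq_tgt_E x) (M.tgt_τ_eq_tgt_E x)

theorem cross_isSymFork (hlt : z'.y l₀ < z'.lo k₀) :
    (M.cross hlt).cover.IsSymFork {M.i, M.j} := by
  refine ⟨M.i, M.j, M.i_ne_j, rfl, M.cross_isEnd_i hlt, M.cross_isEnd_j hlt,
    ⟨c.tgt M.E, ((M.cross hlt).isInner_iff _).2 M.isInner_tgt_E,
      (M.incident_tgt_E_iff _ hlt).2 (by simp), (M.incident_tgt_E_iff _ hlt).2 (by simp)⟩, ?_⟩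
  change M.weight M.i = M.weight M.j
  rw [M.weight_of_ne M.i_ne_E M.i_ne_e, M.weight_of_ne M.j_ne_E M.j_ne_e, M.ω_i_eq_j]

/-- The elements of `Sym_2` of the rewired cover are the new symmetric fork and old elements. -/
theorem old_or_eq_of_mem_sym2 (hlt : z'.y l₀ < z'.lo k₀) {p : Set c.E}
    (hp : p ∈ (M.cross hlt).cover.sym2) : (∀ x ∈ p, M.Old x) ∨ p = {M.i, M.j} := by
  obtain ⟨⟨h1, h2⟩, h3⟩ := hp
  have hce := (M.cross_isContractible_iff hlt _).2 M.isContractible_e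
  have he : M.e ∉ p := fun h => h2 _ h hce
  have heI : (M.cross hlt).curve.Incident M.e (c.src M.E) :=
    Or.inr ((M.tgt_τ_eq_src_E _).2 (Or.inr rfl))
  -- After the rewiring `o` and `h` meet the contractible edge `e`, so neither belongs to an element
  -- of `Sym_2`.
  have ho : M.o ∉ p := fun h =>
    h3 ⟨_, h, M.e, c.src M.E, hce, Or.inr ((M.tgt_τ_eq_src_E _).2 (Or.inl rfl)), heI⟩
  have hh : M.h ∉ p := fun h =>
    h3 ⟨_, h, M.e, c.src M.E, hce, Or.inl ((M.src_σ_eq_src_E _).2 rfl), heI⟩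
  rcases h1 with ⟨a, b, hab, rfl, ha, hb, hsrc, htgt, -⟩ |
    ⟨a, b, hab, rfl, ha, hb, ⟨v, hv, hav, hbv⟩, -⟩
  · left
    -- After the rewiring `E` is the only edge leaving its source, so it has no parallel edge.
    have hE : M.E ∉ ({a, b} : Set c.E) := by
      rintro (h | h)
      · refine hab ?_
        have h4 : c.src (M.σ b) = c.tgt M.E := hsrc.symm.trans ((M.src_σ_eq_tgt_E a).2 h.symm)
        rw [(M.src_σ_eq_tgt_E b).1 h4, h]
      · refine hab ?_
        have h4 : c.src (M.σ a) = c.tgt M.E := hsrc.trans ((M.src_σ_eq_tgt_E b).2 (Eq.symm h))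
        rw [(M.src_σ_eq_tgt_E a).1 h4]
        exact h
    have hend : ∀ x ∈ ({a, b} : Set c.E), ¬ (M.cross hlt).curve.IsEnd x := by
      rintro x (rfl | rfl) <;> assumption
    intro x hx
    refine ⟨fun h => hE (h ▸ hx), fun h => hh (h ▸ hx), fun h => hend x hx ?_,
      fun h => hend x hx ?_, fun h => ho (h ▸ hx), fun h => he (h ▸ hx)⟩
    · rw [h]
      exact M.cross_isEnd_i hlt
    · rw [h]
      exact M.cross_isEnd_j hlt
  · have hend : ∀ x ∈ ({a, b} : Set c.E), (M.cross hlt).curve.IsEnd x := by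
      rintro x (rfl | rfl) <;> assumption
    have hE : M.E ∉ ({a, b} : Set c.E) := fun h => M.cross_not_isEnd_E hlt (hend _ h)
    have hinc : ∀ x ∈ ({a, b} : Set c.E), (M.cross hlt).curve.Incident x v := by
      rintro x (rfl | rfl) <;> assumption
    rw [(M.cross hlt).isInner_iff, ← c.not_isLeaf_iff] at hv
    by_cases hij : M.i ∈ ({a, b} : Set c.E) ∨ M.j ∈ ({a, b} : Set c.E)
    · right
      have hvw : v = c.tgt M.E := by
        rcases hij with h | h
        · rcases hinc _ h with h5 | h5
          · have h6 : c.src (M.σ M.i) = v := h5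
            rw [M.σ_i] at h6
            exact absurd M.isLeaf_src_i (h6 ▸ hv)
          · exact h5.symm.trans ((M.tgt_τ_eq_tgt_E M.i).2 (Or.inl rfl))
        · rcases hinc _ h with h5 | h5
          · have h6 : c.src (M.σ M.j) = v := h5
            rw [M.σ_j] at h6
            exact absurd M.isLeaf_src_j (h6 ▸ hv)
          · exact h5.symm.trans ((M.tgt_τ_eq_tgt_E M.j).2 (Or.inr rfl))
      subst hvw
      have ha' := (M.incident_tgt_E_iff a hlt).1 hav
      have hb' := (M.incident_tgt_E_iff b hlt).1 hbv
      have ha'' := ha'.resolve_left fun h => hE (by simp [h])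
      have hb'' := hb'.resolve_left fun h => hE (by simp [h])
      rcases ha'' with rfl | rfl <;> rcases hb'' with rfl | rfl
      · exact absurd rfl hab
      · rfl
      · exact Set.pair_comm _ _
      · exact absurd rfl hab
    · left
      rw [not_or] at hij
      intro x hx
      exact ⟨fun h => hE (h ▸ hx), fun h => hh (h ▸ hx), fun h => hij.1 (h ▸ hx),
        fun h => hij.2 (h ▸ hx), fun h => ho (h ▸ hx), fun h => he (h ▸ hx)⟩

section Core

variable {VS : Set c.V} {ES : Set c.E} (hcore : c.IsZigzagCore VS ES) (hE : M.E ∈ ES)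

include hcore

theorem e_mem : M.e ∈ ES := hcore.contractible _ M.isContractible_e

theorem u_mem : M.u ∈ VS := M.src_e ▸ (hcore.closed _ (M.e_mem hcore)).1

theorem src_E_mem : c.src M.E ∈ VS := M.tgt_e ▸ (hcore.closed _ (M.e_mem hcore)).2

theorem i_mem : M.i ∈ ES :=
  hcore.mem_of_odd M.odd_i (Or.inr (M.tgt_i ▸ M.u_mem hcore))

theorem j_mem : M.j ∈ ES :=
  hcore.mem_of_odd (M.ω_i_eq_j ▸ M.odd_i) (Or.inr (M.tgt_j ▸ M.src_E_mem hcore))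

/-- As a sum of two odd weights `ω(h)` is even, while the even edges of the core are contractible
and `h` is not. -/
theorem h_notMem : M.h ∉ ES := by
  intro h
  have h1 : Even (c.ω M.h) := by
    rw [M.ω_h]
    exact M.odd_E.add_odd M.odd_o
  rcases M.eq_or_old_of_isContractible (hcore.even _ h h1) with h2 | h2
  · exact M.h_ne_e h2
  · exact h2.2.1 rfl

theorem cross_connected (hlt : z'.y l₀ < z'.lo k₀) {a b : c.V} (ha : a ∈ VS \ M.forkVerts)
    (hb : b ∈ VS \ M.forkVerts) : (M.cross hlt).curve.Reach (ES \ M.forkEdges) a b := by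
  classical
  -- Collapse the vertices lost to the fork into the remaining core: the target of `E` onto its
  -- source, and the leaves of `i` and `j` onto `u`. Each edge of the old core then becomes a point,
  -- the edge `e`, or an edge of the new core.
  let f : c.V → c.V := fun a => if a = c.tgt M.E then c.src M.E else
    if a ∈ M.forkVerts then M.u else a
  have hf : ∀ a, a ∉ M.forkVerts → f a = a := by
    intro a ha
    have h1 : a ≠ c.tgt M.E := fun h => ha (Or.inl h)
    simp [f, h1, ha]
  have hfw : f (c.tgt M.E) = c.src M.E := by simp [f]
  have hfi : f (c.src M.i) = M.u := by
    have h1 := (M.tgt_ne_src_i M.E).symm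
    have h2 : c.src M.i ∈ M.forkVerts := Or.inr (Or.inl rfl)
    simp [f, h1, h2]
  have hfj : f (c.src M.j) = M.u := by
    have h1 := (M.tgt_ne_src_j M.E).symm
    have h2 : c.src M.j ∈ M.forkVerts := Or.inr (Or.inr rfl)
    simp [f, h1, h2]
  have hfu := hf _ M.u_notMem_forkVerts
  have hfv := hf _ M.src_E_notMem_forkVerts
  have he : (M.cross hlt).curve.Reach (ES \ M.forkEdges) M.u (c.src M.E) := by
    refine .rel _ _ ⟨M.e, ⟨M.e_mem hcore, ?_⟩, (M.src_σ_eq_u _).2 (Or.inr rfl),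
      (M.tgt_τ_eq_src_E _).2 (Or.inr rfl)⟩
    rintro (h | h | h)
    · exact M.e_ne_E h
    · exact M.i_ne_e (Eq.symm h)
    · exact M.j_ne_e (Eq.symm h)
  rw [← hf a ha.2, ← hf b hb.2]
  refine eqvGen_map f ?_ (hcore.connected a ha.1 b hb.1)
  rintro a b ⟨x, hx, rfl, rfl⟩
  rcases M.cases_edge x with rfl | rfl | rfl | rfl | rfl | rfl | h
  · rw [hfw, hfv]
    exact .refl _
  · exact absurd hx (M.h_notMem hcore)
  · rw [hfi, M.tgt_i, hfu]
    exact .refl _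
  · rw [hfj, M.tgt_j, hfv]
    exact he
  · rw [M.tgt_o, hfw, hf _ (M.src_notMem_forkVerts M.h_ne_o.symm M.i_ne_o.symm M.j_ne_o.symm)]
    refine .rel _ _ ⟨M.o, ⟨hx, ?_⟩, congrArg c.src M.σ_o, (M.tgt_τ_eq_src_E _).2 (Or.inl rfl)⟩
    rintro (h | h | h)
    · exact M.E_ne_o (Eq.symm h)
    · exact M.i_ne_o (Eq.symm h)
    · exact M.j_ne_o (Eq.symm h)
  · rw [M.src_e, M.tgt_e, hfu, hfv]
    exact he
  · obtain ⟨o1, o2, o3, o4, o5, o6⟩ := id h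
    rw [hf _ (M.src_notMem_forkVerts o2 o3 o4), hf _ (M.tgt_notMem_forkVerts o1 o5)]
    refine .rel _ _ ⟨x, ⟨hx, ?_⟩, congrArg c.src h.σ, congrArg c.tgt h.τ⟩
    rintro (h | h | h)
    · exact o1 h
    · exact o3 h
    · exact o4 h

include hE

theorem tgt_E_mem : c.tgt M.E ∈ VS := (hcore.closed _ hE).2

theorem o_mem : M.o ∈ ES :=
  hcore.mem_of_odd M.odd_o (Or.inr (M.tgt_o ▸ M.tgt_E_mem hcore hE))

/-- A tail containing `h` is the single end `h`, and it moves from the target of `E` to its source.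
Any other tail avoids all changed edges, because `E`, `i`, `j`, `o`, `e` lie in the core; it also
cannot start at a vertex of the fork, where no old edge is attached. -/
theorem cross_tail (hlt : z'.y l₀ < z'.lo k₀) {v : c.V} {vs : Set c.V} {es : Set c.E}
    (hv : v ∈ VS) (ht : c.IsTail v vs es) (h1 : Disjoint vs VS) (h2 : Disjoint es ES) :
    ∃ v' ∈ VS \ M.forkVerts, (M.cross hlt).cover.IsTail v' vs es ∧
      Disjoint vs (VS \ M.forkVerts) ∧ Disjoint es (ES \ M.forkEdges) := by
  have hd1 : Disjoint vs (VS \ M.forkVerts) := h1.mono_right Set.sdiff_subset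
  have hd2 : Disjoint es (ES \ M.forkEdges) := h2.mono_right Set.sdiff_subset
  by_cases hh : M.h ∈ es
  · obtain ⟨rfl, rfl⟩ := ht.eq_of_end hh M.isLeaf_tgt_h fun h =>
      Set.disjoint_left.1 h1 h (M.src_h ▸ M.tgt_E_mem hcore hE)
    refine ⟨c.src M.E, ⟨M.src_E_mem hcore, M.src_E_notMem_forkVerts⟩,
      IsTail.leaf (c := (M.cross hlt).cover) _ _ _ (Or.inl ⟨(M.src_σ_eq_src_E _).2 rfl, ?_⟩)
        (((M.cross hlt).isLeaf_iff _).2 M.isLeaf_tgt_h) ?_, hd1, hd2⟩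
    · exact congrArg c.tgt M.τ_h
    · change Even (M.weight M.h)
      rw [M.weight_of_ne M.h_ne_E M.h_ne_e, M.ω_h]
      exact M.odd_E.add_odd M.odd_o
  · have hes : ∀ x ∈ es, M.Old x := fun x hx => by
      have hx' := Set.disjoint_left.1 h2 hx
      exact ⟨fun h => hx' (h ▸ hE), fun h => hh (h ▸ hx), fun h => hx' (h ▸ M.i_mem hcore),
        fun h => hx' (h ▸ M.j_mem hcore), fun h => hx' (h ▸ M.o_mem hcore hE),
        fun h => hx' (h ▸ M.e_mem hcore)⟩
    refine ⟨v, ⟨hv, fun hvf => ?_⟩, ht.rewire fun x hx => M.cross_fixes hlt (hes x hx), hd1, hd2⟩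
    obtain ⟨x, hx, hxv⟩ := ht.exists_incident
    obtain ⟨o1, o2, o3, o4, o5, o6⟩ := hes x hx
    rcases hxv with rfl | rfl
    · exact M.src_notMem_forkVerts o2 o3 o4 hvf
    · exact M.tgt_notMem_forkVerts o1 o5 hvf

/-- The edges `E`, `i`, `j` now form a fork tail attached at `u`, the only new component of the
complement. The symmetric fork `{i, j}`, the one possible new element of `Sym_2`, has been removed
from the core, while `e`, of changed parity, stays because it is contractible. -/
theorem cross_isZigzagCore (hlt : z'.y l₀ < z'.lo k₀) :
    (M.cross hlt).cover.IsZigzagCore (VS \ M.forkVerts) (ES \ M.forkEdges) := by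
  have hfork : (M.cross hlt).cover.IsTail M.u M.forkVerts M.forkEdges := by
    refine IsTail.fork (c := (M.cross hlt).cover) M.u (c.tgt M.E) (c.src M.i) (c.src M.j)
      M.E M.i M.j ?_ ?_ ?_ M.i_ne_E.symm M.j_ne_E.symm
      (((M.cross hlt).isInner_iff _).2 M.isInner_tgt_E)
      (((M.cross hlt).isLeaf_iff _).2 M.isLeaf_src_i)
      (((M.cross hlt).isLeaf_iff _).2 M.isLeaf_src_j) (M.cross_isSymFork hlt)
    · exact Or.inr ⟨(M.src_σ_eq_tgt_E _).2 rfl, (M.tgt_τ_eq_u _).2 rfl⟩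
    · exact Or.inr ⟨congrArg c.src M.σ_i, (M.tgt_τ_eq_tgt_E _).2 (Or.inl rfl)⟩
    · exact Or.inr ⟨congrArg c.src M.σ_j, (M.tgt_τ_eq_tgt_E _).2 (Or.inr rfl)⟩
  have hu : M.u ∈ VS \ M.forkVerts := ⟨M.u_mem hcore, M.u_notMem_forkVerts⟩
  have hv : c.src M.E ∈ VS \ M.forkVerts := ⟨M.src_E_mem hcore, M.src_E_notMem_forkVerts⟩
  refine ⟨fun x hx => ?_, fun a ha b hb => M.cross_connected hcore hlt ha hb,
    fun p hp x hx => ?_, fun x hx => ?_, ⟨M.u, hu, ((M.cross hlt).isInner_iff _).2 M.isInner_u⟩,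
    fun x hx hev => ?_, fun a ha => ?_, fun x hx => ?_⟩
  · change c.src (M.σ x) ∈ VS \ M.forkVerts ∧ c.tgt (M.τ x) ∈ VS \ M.forkVerts
    rcases M.cases_edge x with rfl | rfl | rfl | rfl | rfl | rfl | h
    · exact absurd (Or.inl rfl) hx.2
    · exact absurd hx.1 (M.h_notMem hcore)
    · exact absurd (Or.inr (Or.inl rfl)) hx.2
    · exact absurd (Or.inr (Or.inr rfl)) hx.2
    · rw [M.σ_o, M.τ_o, M.tgt_j]
      exact ⟨⟨(hcore.closed _ hx.1).1,
        M.src_notMem_forkVerts M.h_ne_o.symm M.i_ne_o.symm M.j_ne_o.symm⟩, hv⟩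
    · rw [M.σ_e, M.τ_e, M.src_e, M.tgt_e]
      exact ⟨hu, hv⟩
    · rw [h.σ, h.τ]
      obtain ⟨o1, o2, o3, o4, o5, o6⟩ := h
      exact ⟨⟨(hcore.closed _ hx.1).1, M.src_notMem_forkVerts o2 o3 o4⟩,
        ⟨(hcore.closed _ hx.1).2, M.tgt_notMem_forkVerts o1 o5⟩⟩
  · change x ∉ ES \ M.forkEdges ∧ c.src (M.σ x) ∉ VS \ M.forkVerts ∧
      c.tgt (M.τ x) ∉ VS \ M.forkVerts
    rcases M.old_or_eq_of_mem_sym2 hlt hp with h | rfl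
    · have h1 := mem_sym2_of_rewire (R := M.cross hlt)
        (fun x hx => ⟨congrArg c.src (M.σ_τ_of_isContractible hx).1,
          congrArg c.tgt (M.σ_τ_of_isContractible hx).2⟩)
        (fun x hx => M.cross_fixes hlt (h x hx)) hp
      obtain ⟨h2, h3, h4⟩ := hcore.disjoint_sym2 p h1 x hx
      rw [(h x hx).σ, (h x hx).τ]
      exact ⟨fun h => h2 h.1, fun h => h3 h.1, fun h => h4 h.1⟩
    · rcases hx with rfl | rfl
      · rw [M.σ_i, M.τ_i]
        exact ⟨fun h => h.2 (Or.inr (Or.inl rfl)), fun h => h.2 (Or.inr (Or.inl rfl)),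
          fun h => h.2 (Or.inl rfl)⟩
      · rw [M.σ_j, M.τ_j, M.tgt_o]
        exact ⟨fun h => h.2 (Or.inr (Or.inr rfl)), fun h => h.2 (Or.inr (Or.inr rfl)),
          fun h => h.2 (Or.inl rfl)⟩
  · rw [M.cross_isContractible_iff] at hx
    refine ⟨hcore.contractible x hx, ?_⟩
    rcases M.eq_or_old_of_isContractible hx with rfl | h
    · rintro (h | h | h)
      · exact M.e_ne_E h
      · exact M.i_ne_e (Eq.symm h)
      · exact M.j_ne_e (Eq.symm h)
    · obtain ⟨o1, o2, o3, o4, o5, o6⟩ := h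
      rintro (h | h | h)
      · exact o1 h
      · exact o3 h
      · exact o4 h
  · change Even (M.weight x) at hev
    rw [M.cross_isContractible_iff]
    rcases M.cases_edge x with rfl | rfl | rfl | rfl | rfl | rfl | h
    · exact absurd (Or.inl rfl) hx.2
    · exact absurd hx.1 (M.h_notMem hcore)
    · exact absurd (Or.inr (Or.inl rfl)) hx.2
    · exact absurd (Or.inr (Or.inr rfl)) hx.2
    · rw [M.weight_of_ne M.E_ne_o.symm M.e_ne_o.symm] at hev
      exact absurd hev (Nat.not_even_iff_odd.2 M.odd_o)
    · exact M.isContractible_e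
    · rw [h.weight] at hev
      exact hcore.even x hx.1 hev
  · by_cases haf : a ∈ M.forkVerts
    · exact ⟨M.u, hu, _, _, hfork, Set.disjoint_sdiff_right, Set.disjoint_sdiff_right, haf⟩
    · obtain ⟨v, hv, vs, es, ht, h1, h2, h3⟩ := hcore.tails.1 a fun h => ha ⟨h, haf⟩
      obtain ⟨v', hv', ht', h1', h2'⟩ := M.cross_tail hcore hE hlt hv ht h1 h2
      exact ⟨v', hv', vs, es, ht', h1', h2', h3⟩
  · by_cases hxf : x ∈ M.forkEdges
    · exact ⟨M.u, hu, _, _, hfork, Set.disjoint_sdiff_right, Set.disjoint_sdiff_right, hxf⟩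
    · obtain ⟨v, hv, vs, es, ht, h1, h2, h3⟩ := hcore.tails.2 x fun h => hx ⟨h, hxf⟩
      obtain ⟨v', hv', ht', h1', h2'⟩ := M.cross_tail hcore hE hlt hv ht h1 h2
      exact ⟨v', hv', vs, es, ht', h1', h2', h3⟩

end Core

end Mark

end TropicalCover

/-! ### Recovering a cover from its rewiring -/

namespace TropicalCover

variable {d s t g : ℕ} {lam mu : Nat.Partition d} {z z' : Distribution s t}

namespace Mark

variable {k₀ : Fin s} {l₀ : Fin t}

open Classical in
/-- The automorphism of the rewired cover that exchanges the two ends of the new symmetric fork. -/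
noncomputable def swapIso {c : TropicalCover g lam mu z} (M : c.Mark k₀ l₀)
    (hlt : z'.y l₀ < z'.lo k₀) : Iso (M.cross hlt).cover (M.cross hlt).cover :=
  Iso.mk' (c := (M.cross hlt).cover) (c' := (M.cross hlt).cover)
    (Equiv.swap (c.src M.i) (c.src M.j)) (Equiv.swap M.i M.j)
    (fun x => by
      change c.src (M.σ (Equiv.swap M.i M.j x)) =
        Equiv.swap (c.src M.i) (c.src M.j) (c.src (M.σ x))
      by_cases hi : x = M.i
      · rw [hi, Equiv.swap_apply_left, M.σ_i, M.σ_j, Equiv.swap_apply_left]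
      by_cases hj : x = M.j
      · rw [hj, Equiv.swap_apply_right, M.σ_i, M.σ_j, Equiv.swap_apply_right]
      rw [Equiv.swap_apply_of_ne_of_ne hi hj, Equiv.swap_apply_of_ne_of_ne]
      · exact fun h => hi (M.σ.injective ((M.src_eq_src_i h).trans M.σ_i.symm))
      · exact fun h => hj (M.σ.injective ((M.src_eq_src_j h).trans M.σ_j.symm)))
    (fun x => by
      change c.tgt (M.τ (Equiv.swap M.i M.j x)) =
        Equiv.swap (c.src M.i) (c.src M.j) (c.tgt (M.τ x))
      rw [Equiv.swap_apply_of_ne_of_ne (M.tgt_ne_src_i _) (M.tgt_ne_src_j _)]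
      by_cases hi : x = M.i
      · rw [hi, Equiv.swap_apply_left, M.τ_i, M.τ_j, M.tgt_o]
      by_cases hj : x = M.j
      · rw [hj, Equiv.swap_apply_right, M.τ_i, M.τ_j, M.tgt_o]
      rw [Equiv.swap_apply_of_ne_of_ne hi hj])
    (fun v => by
      change movePoints z z' (c.φ (Equiv.swap (c.src M.i) (c.src M.j) v)) =
        movePoints z z' (c.φ v)
      by_cases hi : v = c.src M.i
      · rw [hi, Equiv.swap_apply_left, M.φ_src_i, M.φ_src_j]
      by_cases hj : v = c.src M.j
      · rw [hj, Equiv.swap_apply_right, M.φ_src_i, M.φ_src_j]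
      rw [Equiv.swap_apply_of_ne_of_ne hi hj])
    (fun x => by
      change M.weight (Equiv.swap M.i M.j x) = M.weight x
      have h1 : M.weight M.i = M.weight M.j := by
        rw [M.weight_of_ne M.i_ne_E M.i_ne_e, M.weight_of_ne M.j_ne_E M.j_ne_e, M.ω_i_eq_j]
      by_cases hi : x = M.i
      · rw [hi, Equiv.swap_apply_left, h1]
      by_cases hj : x = M.j
      · rw [hj, Equiv.swap_apply_right, h1]
      rw [Equiv.swap_apply_of_ne_of_ne hi hj])

open Classical in
theorem swapIso_edge_j {c : TropicalCover g lam mu z} (M : c.Mark k₀ l₀)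
    (hlt : z'.y l₀ < z'.lo k₀) : (M.swapIso hlt).edge M.j = M.i :=
  Equiv.swap_apply_right _ _

variable {c₁ c₂ : TropicalCover g lam mu z} {M₁ : c₁.Mark k₀ l₀} {M₂ : c₂.Mark k₀ l₀}
variable {hlt : z'.y l₀ < z'.lo k₀} (F : Iso (M₁.cross hlt).cover (M₂.cross hlt).cover)

include F

theorem iso_φ (v : c₁.V) : c₂.φ (F.vert v) = c₁.φ v :=
  movePoints_injOn z z' (c₂.φ_mem_vertexValues _) (c₁.φ_mem_vertexValues _) (F.φ_eq v)

theorem iso_src (x : c₁.E) : c₂.src (M₂.σ (F.edge x)) = F.vert (c₁.src (M₁.σ x)) := F.src_eq x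

theorem iso_tgt (x : c₁.E) : c₂.tgt (M₂.τ (F.edge x)) = F.vert (c₁.tgt (M₁.τ x)) := F.tgt_eq x

theorem iso_weight (x : c₁.E) : M₂.weight (F.edge x) = M₁.weight x := F.ω_eq x

variable (hst : 2 * s + t + 2 = Multiset.card lam.parts + Multiset.card mu.parts + 2 * g)

include hst

/-- There is only one inner vertex over a branch point, so its image under an isomorphism is
determined by its position. -/
theorem iso_vert {a : c₁.V} {b : c₂.V} (ha : c₁.IsInner a) (h : c₁.φ a = c₂.φ b) :
    F.vert a = b := by
  obtain ⟨k, hk⟩ := c₁.exists_point_of_isInner ha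
  have h1 := (iso_φ F a).trans h
  exact c₂.φ_injOn hst (c₂.isInner_of_eq (h1.trans (h.symm.trans hk)))
    (c₂.isInner_of_eq (h.symm.trans hk)) h1

theorem iso_u : F.vert M₁.u = M₂.u :=
  iso_vert F hst M₁.isInner_u (M₁.φ_u.trans M₂.φ_u.symm)

theorem iso_src_E : F.vert (c₁.src M₁.E) = c₂.src M₂.E :=
  iso_vert F hst M₁.isInner_src_E (M₁.φ_src_E.trans M₂.φ_src_E.symm)

theorem iso_tgt_E : F.vert (c₁.tgt M₁.E) = c₂.tgt M₂.E :=
  iso_vert F hst M₁.isInner_tgt_E (M₁.φ_tgt_E.trans M₂.φ_tgt_E.symm)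

theorem iso_E : F.edge M₁.E = M₂.E := by
  rw [← M₂.src_σ_eq_tgt_E, iso_src, (M₁.src_σ_eq_tgt_E _).2 rfl, iso_tgt_E F hst]

theorem iso_h : F.edge M₁.h = M₂.h := by
  rw [← M₂.src_σ_eq_src_E, iso_src, (M₁.src_σ_eq_src_E _).2 rfl, iso_src_E F hst]

theorem iso_e : F.edge M₁.e = M₂.e := by
  -- Incidence at `u` and at the former source of `E` together single out `e`, since `f ≠ o`.
  have h1 : F.edge M₁.e = M₂.f ∨ F.edge M₁.e = M₂.e := by
    rw [← M₂.src_σ_eq_u, iso_src, (M₁.src_σ_eq_u _).2 (Or.inr rfl), iso_u F hst]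
  have h2 : F.edge M₁.e = M₂.o ∨ F.edge M₁.e = M₂.e := by
    rw [← M₂.tgt_τ_eq_src_E, iso_tgt, (M₁.tgt_τ_eq_src_E _).2 (Or.inr rfl), iso_src_E F hst]
  rcases h1 with h1 | h1
  · exact h2.resolve_left fun h => M₂.f_ne_o (h1.symm.trans h)
  · exact h1

theorem iso_o : F.edge M₁.o = M₂.o := by
  have h2 : F.edge M₁.o = M₂.o ∨ F.edge M₁.o = M₂.e := by
    rw [← M₂.tgt_τ_eq_src_E, iso_tgt, (M₁.tgt_τ_eq_src_E _).2 (Or.inl rfl), iso_src_E F hst]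
  exact h2.resolve_right fun h => M₁.e_ne_o (F.edge.injective ((iso_e F hst).trans h.symm))

theorem iso_i : F.edge M₁.i = M₂.i ∨ F.edge M₁.i = M₂.j := by
  rw [← M₂.tgt_τ_eq_tgt_E, iso_tgt, (M₁.tgt_τ_eq_tgt_E _).2 (Or.inl rfl), iso_tgt_E F hst]

theorem iso_j : F.edge M₁.j = M₂.i ∨ F.edge M₁.j = M₂.j := by
  rw [← M₂.tgt_τ_eq_tgt_E, iso_tgt, (M₁.tgt_τ_eq_tgt_E _).2 (Or.inr rfl), iso_tgt_E F hst]

/-- Once `F` matches all the marked edges it commutes with the permutations `σ` and `τ`, so the same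
bijections respect the original incidences. -/
theorem nonempty_iso_of_cross_of_edge_i (hi : F.edge M₁.i = M₂.i) : Nonempty (Iso c₁ c₂) := by
  have hj : F.edge M₁.j = M₂.j := (iso_j F hst).resolve_left fun h =>
    M₁.i_ne_j (F.edge.injective (hi.trans h.symm))
  have hE := iso_E F hst
  have hh := iso_h F hst
  have he := iso_e F hst
  have ho := iso_o F hst
  have hne : ∀ {x y : c₁.E} {y' : c₂.E}, F.edge y = y' → x ≠ y → F.edge x ≠ y' :=
    fun h hxy h' => hxy (F.edge.injective (h'.trans h.symm))
  have hold : ∀ x, M₁.Old x → M₂.Old (F.edge x) := fun x ⟨h1, h2, h3, h4, h5, h6⟩ =>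
    ⟨hne hE h1, hne hh h2, hne hi h3, hne hj h4, hne ho h5, hne he h6⟩
  have hσ : ∀ x, M₂.σ (F.edge x) = F.edge (M₁.σ x) := by
    intro x
    rcases M₁.cases_edge x with rfl | rfl | rfl | rfl | rfl | rfl | h
    · rw [hE, M₁.σ_E, M₂.σ_E, hh]
    · rw [hh, M₁.σ_h, M₂.σ_h, hE]
    · rw [hi, M₁.σ_i, M₂.σ_i, hi]
    · rw [hj, M₁.σ_j, M₂.σ_j, hj]
    · rw [ho, M₁.σ_o, M₂.σ_o, ho]
    · rw [he, M₁.σ_e, M₂.σ_e, he]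
    · rw [h.σ, (hold x h).σ]
  have hτ : ∀ x, M₂.τ (F.edge x) = F.edge (M₁.τ x) := by
    intro x
    rcases M₁.cases_edge x with rfl | rfl | rfl | rfl | rfl | rfl | h
    · rw [hE, M₁.τ_E, M₂.τ_E, hi]
    · rw [hh, M₁.τ_h, M₂.τ_h, hh]
    · rw [hi, M₁.τ_i, M₂.τ_i, hE]
    · rw [hj, M₁.τ_j, M₂.τ_j, ho]
    · rw [ho, M₁.τ_o, M₂.τ_o, hj]
    · rw [he, M₁.τ_e, M₂.τ_e, he]
    · rw [h.τ, (hold x h).τ]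
  have hw : ∀ x, x ≠ M₁.E → x ≠ M₁.e → c₂.ω (F.edge x) = c₁.ω x := by
    intro x h1 h2
    rw [← M₁.weight_of_ne h1 h2, ← M₂.weight_of_ne (hne hE h1) (hne he h2), iso_weight F]
  have hwE : c₂.ω M₂.E = c₁.ω M₁.E := by
    rw [← M₁.weight_e, ← M₂.weight_e, ← he, iso_weight F]
  refine ⟨Iso.mk' (c := c₁) (c' := c₂) F.vert F.edge (fun x => ?_) (fun x => ?_) (iso_φ F)
    fun x => ?_⟩
  · have := iso_src F (M₁.σ.symm x)
    rwa [hσ, M₁.σ.apply_symm_apply] at this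
  · have := iso_tgt F (M₁.τ.symm x)
    rwa [hτ, M₁.τ.apply_symm_apply] at this
  · by_cases h1 : x = M₁.E
    · subst h1
      rw [hE, hwE]
    by_cases h2 : x = M₁.e
    · subst h2
      -- The weight of `e` was overwritten by that of the old `E`; it is recovered as `ω(E) - ω(j)`.
      have h3 := hw M₁.j M₁.j_ne_E M₁.j_ne_e
      rw [hj] at h3
      have h4 := M₁.ω_E
      have h5 := M₂.ω_E
      rw [he]
      omega
    · exact hw x h1 h2

/-- A cover can be recovered from the rewired cover. -/
theorem nonempty_iso_of_cross : Nonempty (Iso c₁ c₂) := by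
  rcases iso_i F hst with h | h
  · exact nonempty_iso_of_cross_of_edge_i F hst h
  -- If `F` exchanges the two ends of the fork, composing with its automorphism reduces to the
  -- previous case.
  · let G := M₂.swapIso hlt
    let H : Iso (M₁.cross hlt).cover (M₂.cross hlt).cover :=
      Iso.mk' (F.vert.trans G.vert) (F.edge.trans G.edge)
        (fun e => (G.src_eq _).trans (congrArg G.vert (F.src_eq e)))
        (fun e => (G.tgt_eq _).trans (congrArg G.vert (F.tgt_eq e)))
        (fun v => (G.φ_eq _).trans (F.φ_eq v)) (fun e => (G.ω_eq _).trans (F.ω_eq e))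
    refine nonempty_iso_of_cross_of_edge_i H hst ?_
    exact (congrArg G.edge h).trans (M₂.swapIso_edge_j hlt)

end Mark

end TropicalCover

/-! ### The injection of isomorphism classes -/

open TropicalCover

variable {d s t g : ℕ} {lam mu : Nat.Partition d}

/-- Every properly mixed cover gives rise to a generalized zigzag cover over any other
distribution, from which it can be recovered. -/
theorem exists_genZigzag_of_isProperlyMixed
    (hst : 2 * s + t + 2 = Multiset.card lam.parts + Multiset.card mu.parts + 2 * g)
    {w : Fin (2 * s + t) → ℝ} {hw : StrictMono w} (z : Distribution s t) :
    ∃ T : {c : TropicalCover g lam mu (trivialDistribution s t w hw) // IsProperlyMixed c} →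
        {c : TropicalCover g lam mu z // c.IsGenZigzag},
      ∀ c₁ c₂, Nonempty (Iso (T c₁).1 (T c₂).1) → Nonempty (Iso c₁.1 c₂.1) := by
  rcases isEmpty_or_nonempty {c : TropicalCover g lam mu (trivialDistribution s t w hw) //
    IsProperlyMixed c} with hemp | ⟨⟨c, hc⟩⟩
  · exact ⟨fun c => (hemp.false c).elim, fun c => (hemp.false c).elim⟩
  -- One cover supplies the first pair and the last single point, which need `s, t > 0`. These
  -- indices serve all properly mixed covers, so the choice between the two constructions depends on
  -- `z` alone.
  obtain ⟨k₀, l₀, -, hk₀, hl₀, -⟩ := hc.exists_mark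
  have hM : ∀ c : {c : TropicalCover g lam mu (trivialDistribution s t w hw) //
      IsProperlyMixed c}, ∃ M : c.1.Mark k₀ l₀, ∃ VS ES, c.1.IsZigzagCore VS ES ∧ M.E ∈ ES := by
    rintro ⟨c, hc⟩
    obtain ⟨k, l, M, hk, hl, h⟩ := hc.exists_mark
    obtain rfl : k = k₀ := Fin.ext (by omega)
    obtain rfl : l = l₀ := Fin.ext (by omega)
    exact ⟨M, h⟩
  choose M VS ES hcore hE using hM
  by_cases h : z.y l₀ < z.lo k₀
  · exact ⟨fun c => ⟨((M c).cross h).cover, (M c).cross_isResolving h c.2.1, _, _,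
      (M c).cross_isZigzagCore (hcore c) (hE c) h⟩,
      fun c₁ c₂ ⟨F⟩ => Mark.nonempty_iso_of_cross F hst⟩
  · have h' : z.hi k₀ < z.y l₀ := by
      by_contra h'
      exact z.y_notMem k₀ l₀ ⟨not_lt.1 h, not_lt.1 h'⟩
    exact ⟨fun c => ⟨((M c).keep h').cover,
      IsGenZigzag.rewire ⟨c.2.1, _, _, hcore c⟩ ((M c).keep_fixes h')⟩,
      fun c₁ c₂ ⟨F⟩ => nonempty_iso_of_rewire_fixes ((M c₁).keep_fixes h')
        ((M c₂).keep_fixes h') F⟩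

/-- Every summand is a power of two, hence at least `1`. Finiteness is essential, as a `finsum` with
infinite support would be zero. -/
theorem card_zigzagClasses_le_zigzagNumber (z : Distribution s t)
    [Finite (ZigzagClasses g lam mu z)] :
    Nat.card (ZigzagClasses g lam mu z) ≤ zigzagNumber g lam mu z := by
  have := Fintype.ofFinite (ZigzagClasses g lam mu z)
  rw [zigzagNumber, finsum_eq_sum_of_fintype, Nat.card_eq_fintype_card, ← Finset.card_univ,
    Finset.card_eq_sum_ones]
  exact Finset.sum_le_sum fun q _ => Nat.one_le_two_pow

end Zigzag

theorem theorem5p3 {d : ℕ} (g s t : ℕ) (lam mu : Nat.Partition d)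
    (hst : 2 * s + t + 2 = Multiset.card lam.parts + Multiset.card mu.parts + 2 * g)
    (Λ : Fin (s + t) → Nat.Partition d) (hΛ : Zigzag.IsTuple s t Λ)
    (w : Fin (2 * s + t) → ℝ) (hw : StrictMono w)
    (z : Zigzag.Distribution s t) (hz : z.Compatible Λ) :
    Finite (Zigzag.ProperClasses g lam mu s t w hw) ∧
    Finite (Zigzag.ZigzagClasses g lam mu z) ∧
    Zigzag.properZigzagNumber g lam mu s t w hw ≤ Zigzag.zigzagNumber g lam mu z := by
  have h1 : Finite (Zigzag.ProperClasses g lam mu s t w hw) :=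
    Zigzag.TropicalCover.finite_classes hst _
  have h2 : Finite (Zigzag.ZigzagClasses g lam mu z) :=
    Zigzag.TropicalCover.finite_classes hst _
  refine ⟨h1, h2, le_trans ?_ (Zigzag.card_zigzagClasses_le_zigzagNumber z)⟩
  obtain ⟨T, hT⟩ := Zigzag.exists_genZigzag_of_isProperlyMixed (w := w) (hw := hw) hst z
  -- Since `T` is applied to chosen representatives, it need not respect isomorphisms; it only has
  -- to reflect them.
  let f (q : Zigzag.ProperClasses g lam mu s t w hw) : Zigzag.ZigzagClasses g lam mu z :=
    Quotient.mk _ (T q.out)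
  refine Nat.card_le_card_of_injective f fun q q' h => ?_
  rw [← q.out_eq, ← q'.out_eq]
  exact Quotient.sound (hT _ _ (Quotient.exact h))
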